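/- **Setting.** A \emph{hard pulse} is a sequence $(\omega_j)_{j\in\mathbb Z}$ of complex numbers with $\sum_j|\omega_j|<\infty$ and $|\omega_j|<\pi$ for all $j$; it has $\rho$ \emph{rephasing time steps} ($\rho\in\mathbb Z$) if $\omega_j=0$ for all $j\ge\rho$. For $w\in S^1$ let $P_w$ be the rotation of $\mathbb R^3$ about the $z$-axis that multiplies $v_x+iv_y$ by $w$, and for $c\in\mathbb C$ let $R_c$ be the right-handed rotation by the angle $|c|$ about the axis $(\operatorname{Re}c,\operatorname{Im}c,0)$ ($R_0$ is the identity). A function $\mathbf M:S^1\to S^2\subset\mathbb R^3$ is the \emph{discrete selective excitation transform} of $\Omega=(\omega_j)$, written $\mathcal T^{\mathrm{disc}}\Omega=\mathbf M$, if for every $w\in S^1$ there is a sequence $M_-(w;j)\in\mathbb R^3$, $j\in\mathbb Z$, with $$M_-(w;j+1)=P_wR_{\omega_j}M_-(w;j),\qquad \lim_{j\to-\infty}M_-(w;j)=(0,0,1)^T,\qquad \lim_{j\to+\infty}P_w^{-j}M_-(w;j)=\mathbf M(w).$$ **Statement.** Let $\mathbf M=(\mathbf M_x,\mathbf M_y,\mathbf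 M_z):S^1\to S^2$ satisfy $\mathbf M_z\neq-1$ everywhere, and suppose that its reflection coefficient $$r=\frac{\mathbf M_x+i\mathbf M_y}{1+\mathbf M_z}$$ is in the Sobolev space $H^1(S^1)$. Let $\rho\in\mathbb Z$ and suppose that $r(w)=w^{-\rho}r_0(w)$ on $S^1$, where $r_0$ extends to a meromorphic function on the open unit disk $\mathbb D$ (again denoted $r_0$) that has the boundary value $r_0(w)$ at every $w\in S^1$ (that is, $r_0(z)\to r_0(w)$ as $z\to w$, $z\in\mathbb D$) and that vanishes at the origin. Then $r_0$ has only finitely many poles $w_1,\dots,w_m$ in $\mathbb D$; let $d_1,\dots,d_m$ be their multiplicities. There exists a hard pulse $\Omega=(\omega_j)$ with $\rho$ rephasing time steps such that $\mathcal T^{\mathrm{disc}}\Omega=\mathbf M$, and every such pulse satisfies $$\sum_{j=-\infty}^{\infty}\log\Bigl(1+\tan^2\frac{|\omega_j|}{2}\Bigr)=\frac1{2\pi}\int_0^{2\pi}\log\bigl(1+|r(e^{i\theta})|^2\bigr)\,d\theta-2\sum_{k=1}^m d_k\log|w_k| .$$ -/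

import Mathlib

open Filter Topology MeasureTheory
open scoped Matrix

noncomputable section

/-- Membership in the Sobolev space `H¹(S¹)`: square integrable, with a square integrable weak
derivative `g` in the angular variable (tested against smooth `2π`-periodic functions). -/
def MemSobolevH1 (f : Circle → ℂ) : Prop :=
  MemLp (fun θ : ℝ => f (Circle.exp θ)) 2 (volume.restrict (Set.Ioc 0 (2 * Real.pi))) ∧
  ∃ g : Circle → ℂ,
    MemLp (fun θ : ℝ => g (Circle.exp θ)) 2 (volume.restrict (Set.Ioc 0 (2 * Real.pi))) ∧
    ∀ φ : ℝ → ℂ, ContDiff ℝ (⊤ : ℕ∞) φ → Function.Periodic φ (2 * Real.pi) →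
      (∫ θ in (0 : ℝ)..(2 * Real.pi), f (Circle.exp θ) * deriv φ θ) +
        (∫ θ in (0 : ℝ)..(2 * Real.pi), g (Circle.exp θ) * φ θ) = 0

/-- Free precession during one time step: rotation about the `z`-axis which multiplies the
transverse component `v_x + i v_y` by `w = exp (i Δ z)`. -/
def precession (w : Circle) (v : Fin 3 → ℝ) : Fin 3 → ℝ :=
  ![((w : ℂ) * (v 0 + Complex.I * v 1)).re, ((w : ℂ) * (v 0 + Complex.I * v 1)).im, v 2]

/-- Effect of one hard pulse `c`: the right-handed rotation by the angle `|c|` about the axis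
`(Re c, Im c, 0)` (Rodrigues' formula; the identity for `c = 0`). -/
def pulseRotation (c : ℂ) (v : Fin 3 → ℝ) : Fin 3 → ℝ :=
  let n : Fin 3 → ℝ := ![c.re / ‖c‖, c.im / ‖c‖, 0]
  Real.cos ‖c‖ • v + Real.sin ‖c‖ • (n ⨯₃ v) + ((1 - Real.cos ‖c‖) * (n ⬝ᵥ v)) • n

/-- `M` is the magnetization profile resulting from the hard pulse `ω`, i.e. `M` is the discrete
selective excitation transform of `ω`: for every `w` the magnetization `m` starts at equilibrium
at `j = -∞`, evolves by the discrete Bloch recursion, and its rephased limit at `+∞` is `M w`. -/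
def IsExcitationTransform (ω : ℤ → ℂ) (M : Circle → Fin 3 → ℝ) : Prop :=
  ∀ w : Circle, ∃ m : ℤ → Fin 3 → ℝ,
    (∀ j, m (j + 1) = precession w (pulseRotation (ω j) (m j))) ∧
    Tendsto m atBot (𝓝 ![0, 0, 1]) ∧
    Tendsto (fun j : ℤ => precession (w ^ (-j)) (m j)) atTop (𝓝 (M w))

/-- The reflection coefficient `(M_x + i M_y) / (1 + M_z)` of a magnetization profile. -/
def reflectionCoeff (M : Circle → Fin 3 → ℝ) (w : Circle) : ℂ :=
  ((M w 0 : ℂ) + Complex.I * (M w 1 : ℂ)) / (1 + (M w 2 : ℂ))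

/-- `F` is a meromorphic extension of `f : S¹ → ℂ` to the open unit disk: `F` is meromorphic in
the disk and has the boundary values `f`. -/
structure IsMeromorphicExtension (f : Circle → ℂ) (F : ℂ → ℂ) : Prop where
  meromorphic : MeromorphicOn F (Metric.ball 0 1)
  boundary : ∀ w : Circle, Tendsto F (𝓝[Metric.ball 0 1] (w : ℂ)) (𝓝 (f w))

/-- The poles of `F` in the open unit disk. -/
def diskPoles (F : ℂ → ℂ) : Set ℂ :=
  {z | z ∈ Metric.ball (0 : ℂ) 1 ∧ meromorphicOrderAt F z < 0}

/-- The multiplicity of a pole. -/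
def poleMultiplicity (F : ℂ → ℂ) (z : ℂ) : ℕ :=
  (-(meromorphicOrderAt F z).untop₀).toNat

/-- `ω` is a hard pulse with `ρ` rephasing time steps which produces the profile `M`. The strengths
are absolutely summable and each flip angle `|ω j|` is less than `π`, so that
`tan (|ω j| / 2)` is a genuine tangent. -/
structure IsRephasedPulse (ρ : ℤ) (M : Circle → Fin 3 → ℝ) (ω : ℤ → ℂ) : Prop where
  summable : Summable fun j => ‖ω j‖
  norm_lt_pi : ∀ j, ‖ω j‖ < Real.pi
  rephasing : ∀ j, ρ ≤ j → ω j = 0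
  transform : IsExcitationTransform ω M

end

/-! A magnetization vector is stored in homogeneous coordinates `(A, B)` with stereographic
projection `B / A`. A pulse acts by `(A, B) ↦ (A - γ̄ B, B + γ A)` with `|γ| = tan (|ω| / 2)`, and
precession multiplies `B` by `w`. Since nothing happens after time `ρ` except precession, the task
is to produce the ratio `r₀` on the circle at time `ρ`.

Existence. The poles of `F` cannot accumulate at the circle, where `F` has finite limits, so `r₀ = P
/ Q` with `Q` the pole polynomial and `P` in the disk algebra. An outer function `V` normalizes `A =
Q V`, `B = P V` to `|A|² + |B|² = 1` on the circle. A Bézout identity `E P V + D Q = 1` makes `l =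
(B̄ - E) / A` satisfy `B̄ = A l + E` and `Ā = D / V - B l`. The analytic terms have no negative
frequencies, so the negative Fourier coefficients of these two equations form a Marchenko system
whose Hankel kernel `lam` comes from `l` (`isMarchenkoSolution_fourierCoeff`). Removing the last
pulse, with parameter `b 0 / a 0`, yields a solution of the system with kernel shifted by one
(`IsMarchenkoSolution.strip`). The `ℓ¹` norm `t k` of the kernel after `k` shifts tends to zero.
Hence the remaining ratio `B / A` tends to zero, which is the approach to equilibrium at `-∞`, and
the `k`-th parameter is at most `‖lam k‖ + 2 (t k)³` for large `k`. Regularity `H¹` gives `t k =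
O(k^(-1/2))`, so the pulse is summable.

Energy. For an arbitrary admissible pulse the forward recursion converges to disk algebra functions
`A`, `B` without common zeros in the closed disk, with `A 0 = 1`, `B = A r₀` on the circle and `|A|²
+ |B|² = N = ∏ (1 + |γ k|²)` there. Then `A = Q H` and `B = P H` with `H` zero-free and `|H| = √N
|V|` on the circle; the maximum principle for `H / V` and `V / H` gives `N |Q 0|² |V 0|² = 1`
(`IsScatteringPair.norm_mul_eq_one`). Taking logarithms, `log |V 0|` is a mean over the circle, `log
|Q|` has mean zero there because the zeros of `Q` lie in the disk, and `Q 0` contributes the sum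
over the poles. -/

open ComplexConjugate

/-! ### Hankel sums of absolutely summable sequences -/

theorem summable_norm_add {lam : ℕ → ℂ} (hl : Summable fun n => ‖lam n‖) (m : ℕ) :
    Summable fun n => ‖lam (m + n)‖ := by
  simpa [add_comm] using (summable_nat_add_iff m).2 hl

theorem tsum_norm_add_le {lam : ℕ → ℂ} (hl : Summable fun n => ‖lam n‖) (m : ℕ) :
    ∑' n, ‖lam (m + n)‖ ≤ ∑' n, ‖lam n‖ := by
  have h := hl.sum_add_tsum_nat_add m
  have h' : ∑' n, ‖lam (m + n)‖ = ∑' n, ‖lam (n + m)‖ := by simp [add_comm]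
  have : 0 ≤ ∑ i ∈ Finset.range m, ‖lam i‖ := Finset.sum_nonneg fun _ _ => norm_nonneg _
  linarith

theorem summable_tsum_hankel_prod {lam x : ℕ → ℂ} (hl : Summable fun n => ‖lam n‖)
    (hx : Summable fun n => ‖x n‖) :
    Summable fun n : ℕ => ∑' m, ‖lam (n + m)‖ * ‖x n‖ := by
  refine Summable.of_nonneg_of_le (fun n => tsum_nonneg fun m => by positivity) (fun n => ?_)
    (hx.mul_left (∑' n, ‖lam n‖))
  rw [tsum_mul_right]
  exact mul_le_mul_of_nonneg_right (tsum_norm_add_le hl n) (norm_nonneg _)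

/-- Summing over the second index first leaves a tail of `lam`, bounded by its full `ℓ¹` norm. Joint
summability is what permits the interchange of sums in the operator bound. -/
theorem summable_hankel_prod {lam x : ℕ → ℂ} (hl : Summable fun n => ‖lam n‖)
    (hx : Summable fun n => ‖x n‖) :
    Summable fun p : ℕ × ℕ => ‖lam (p.1 + p.2)‖ * ‖x p.1‖ := by
  have h0 : (0 : ℕ × ℕ → ℝ) ≤ fun p => ‖lam (p.1 + p.2)‖ * ‖x p.1‖ := fun p =>
    mul_nonneg (norm_nonneg _) (norm_nonneg _)
  exact (summable_prod_of_nonneg h0).2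
    ⟨fun n => (summable_norm_add hl n).mul_right ‖x n‖, summable_tsum_hankel_prod hl hx⟩

theorem summable_hankel {lam x : ℕ → ℂ} (hl : Summable fun n => ‖lam n‖)
    (hx : Summable fun n => ‖x n‖) (m : ℕ) :
    Summable fun n => ‖lam (m + n) * x n‖ := by
  have := ((summable_hankel_prod hl hx).prod_symm).prod_factor m
  simpa [add_comm] using this

theorem summable_norm_hankel {lam x : ℕ → ℂ} (hl : Summable fun n => ‖lam n‖)
    (hx : Summable fun n => ‖x n‖) :
    Summable fun m => ‖∑' n, lam (m + n) * x n‖ := by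
  refine Summable.of_nonneg_of_le (fun _ => norm_nonneg _) (fun m => ?_)
    ((summable_hankel_prod hl hx).prod_symm).prod
  refine (norm_tsum_le_tsum_norm (summable_hankel hl hx m)).trans (le_of_eq ?_)
  simp [add_comm]

/-- The norm of a Hankel operator on `ℓ¹` is bounded by the `ℓ¹` norm of its symbol. -/
theorem tsum_norm_hankel_le {lam x : ℕ → ℂ} (hl : Summable fun n => ‖lam n‖)
    (hx : Summable fun n => ‖x n‖) :
    ∑' m, ‖∑' n, lam (m + n) * x n‖ ≤ (∑' n, ‖lam n‖) * ∑' n, ‖x n‖ := by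
  have hs := summable_hankel_prod hl hx
  calc ∑' m, ‖∑' n, lam (m + n) * x n‖
      ≤ ∑' m, ∑' n, ‖lam (n + m)‖ * ‖x n‖ := by
        refine (summable_norm_hankel hl hx).tsum_le_tsum (fun m => ?_) hs.prod_symm.prod
        refine (norm_tsum_le_tsum_norm (summable_hankel hl hx m)).trans (le_of_eq ?_)
        simp [add_comm]
    _ = ∑' n, ∑' m, ‖lam (n + m)‖ * ‖x n‖ :=
        (Summable.tsum_comm (f := fun n m => ‖lam (n + m)‖ * ‖x n‖) hs)
    _ ≤ ∑' n, (∑' m, ‖lam m‖) * ‖x n‖ := by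
        refine hs.prod.tsum_le_tsum (fun n => ?_) (hx.mul_left _)
        rw [tsum_mul_right]
        exact mul_le_mul_of_nonneg_right (tsum_norm_add_le hl n) (norm_nonneg _)
    _ = _ := tsum_mul_left

/-! ### Layer stripping for solutions of the Marchenko equations -/

/-- The Taylor coefficients `a` of `A` and `b` of `B / z` solve the Marchenko equations with the
kernel `lam`. -/
structure IsMarchenkoSolution (lam a b : ℕ → ℂ) : Prop where
  summable_lam : Summable fun n => ‖lam n‖
  summable_a : Summable fun n => ‖a n‖
  summable_b : Summable fun n => ‖b n‖
  ne_zero : a 0 ≠ 0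
  conj_b : ∀ m, conj (b m) = ∑' n, lam (m + n) * a n
  conj_a : ∀ m, conj (a (m + 1)) = -∑' n, lam (m + 1 + n) * b n

/-- Remove the outermost pulse: new coefficients of `A`. -/
noncomputable def stripA (a b : ℕ → ℂ) (n : ℕ) : ℂ := a n + conj (b 0 / a 0) * b n

/-- Remove the outermost pulse: new coefficients of `B / z`. -/
noncomputable def stripB (a b : ℕ → ℂ) (n : ℕ) : ℂ := b (n + 1) - b 0 / a 0 * a (n + 1)

namespace IsMarchenkoSolution

variable {lam a b : ℕ → ℂ}

/-- Stripping multiplies the leading coefficient by a factor at least one, so it stays nonzero and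
the next parameter is defined. -/
theorem stripA_zero (h : IsMarchenkoSolution lam a b) :
    stripA a b 0 = (1 + (‖b 0 / a 0‖ : ℂ) ^ 2) * a 0 := by
  have h0 := h.ne_zero
  have : b 0 = b 0 / a 0 * a 0 := by field_simp
  rw [stripA, ← Complex.conj_mul']
  linear_combination conj (b 0 / a 0) * this

/-- A Hankel kernel sees only `m + n`, so the equations at index `m + 1`, combined linearly, are
again equations with the shifted kernel. -/
theorem strip (h : IsMarchenkoSolution lam a b) :
    IsMarchenkoSolution (fun n => lam (n + 1)) (stripA a b) (stripB a b) := by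
  have h0 := h.ne_zero
  have hl1 := (summable_nat_add_iff 1).2 h.summable_lam
  have sa := fun m => (summable_hankel h.summable_lam h.summable_a m).of_norm
  have sb := fun m => (summable_hankel h.summable_lam h.summable_b m).of_norm
  refine ⟨hl1, ?_, ?_, ?_, fun m => ?_, fun m => ?_⟩
  · refine Summable.of_nonneg_of_le (fun _ => norm_nonneg _) (fun n => norm_add_le _ _)
      (h.summable_a.add ?_)
    simpa [norm_mul] using h.summable_b.mul_left ‖b 0 / a 0‖
  · refine Summable.of_nonneg_of_le (fun _ => norm_nonneg _) (fun n => norm_sub_le _ _)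
      (((summable_nat_add_iff 1).2 h.summable_b).add ?_)
    simpa [norm_mul] using ((summable_nat_add_iff 1).2 h.summable_a).mul_left ‖b 0 / a 0‖
  · rw [h.stripA_zero]
    refine mul_ne_zero ?_ h0
    have : (0 : ℝ) < 1 + ‖b 0 / a 0‖ ^ 2 := by positivity
    exact_mod_cast this.ne'
  · have e : ∀ n, lam (m + n + 1) * stripA a b n
        = lam (m + 1 + n) * a n + conj (b 0 / a 0) * (lam (m + 1 + n) * b n) := fun n => by
      rw [stripA, add_right_comm]; ring
    simp_rw [e]
    rw [(sa (m + 1)).tsum_add ((sb (m + 1)).mul_left _), tsum_mul_left, ← h.conj_b, stripB, map_sub,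
      map_mul, h.conj_a]
    ring
  · have hb := h.conj_b (m + 1)
    have ha := h.conj_a m
    rw [(sa (m + 1)).tsum_eq_zero_add] at hb
    rw [(sb (m + 1)).tsum_eq_zero_add] at ha
    have sa' := (summable_nat_add_iff 1).2 (sa (m + 1))
    have sb' := (summable_nat_add_iff 1).2 (sb (m + 1))
    have e : ∀ n, lam (m + 1 + n + 1) * stripB a b n
        = lam (m + 1 + (n + 1)) * b (n + 1) - b 0 / a 0 * (lam (m + 1 + (n + 1)) * a (n + 1)) :=
      fun n => by rw [stripB, add_assoc (m + 1)]; ring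
    simp_rw [e]
    rw [sb'.tsum_sub (sa'.mul_left _), tsum_mul_left, stripA, map_add, map_mul,
      Complex.conj_conj, ha, hb]
    -- The `n = 0` terms, which the shifted system lacks, cancel exactly because the parameter is `b
    -- 0 / a 0`.
    have : b 0 = b 0 / a 0 * a 0 := by field_simp
    linear_combination (-lam (m + 1 + 0)) * this

theorem tsum_norm_b_le (h : IsMarchenkoSolution lam a b) :
    ∑' n, ‖b n‖ ≤ (∑' n, ‖lam n‖) * ∑' n, ‖a n‖ := by
  refine le_trans (le_of_eq ?_) (tsum_norm_hankel_le h.summable_lam h.summable_a)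
  simp_rw [← h.conj_b, RCLike.norm_conj]

theorem tsum_norm_a_succ_le (h : IsMarchenkoSolution lam a b) :
    ∑' n, ‖a (n + 1)‖ ≤ (∑' n, ‖lam n‖) * ∑' n, ‖b n‖ := by
  have h1 := summable_norm_hankel h.summable_lam h.summable_b
  have h2 := h1.sum_add_tsum_nat_add 1
  have h3 := tsum_norm_hankel_le h.summable_lam h.summable_b
  have h4 : ∑' n, ‖a (n + 1)‖ = ∑' m, ‖∑' n, lam (m + 1 + n) * b n‖ := by
    refine tsum_congr fun m => ?_
    rw [← RCLike.norm_conj (a (m + 1)), h.conj_a, norm_neg]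
  have h5 : 0 ≤ ∑ i ∈ Finset.range 1, ‖∑' n, lam (i + n) * b n‖ :=
    Finset.sum_nonneg fun _ _ => norm_nonneg _
  linarith

/-- Feeding one Marchenko equation into the other bounds the tail of `a` by `t² ≤ 1/4` times its
whole norm, where `t` is the norm of the kernel; thus `a 0` carries most of the mass. -/
theorem tsum_norm_a_le (h : IsMarchenkoSolution lam a b) (ht : ∑' n, ‖lam n‖ ≤ 1 / 2) :
    ∑' n, ‖a n‖ ≤ 2 * ‖a 0‖ := by
  have h1 := h.tsum_norm_a_succ_le
  have h2 := h.tsum_norm_b_le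
  have h3 := h.summable_a.sum_add_tsum_nat_add 1
  rw [Finset.sum_range_one] at h3
  have hS : 0 ≤ ∑' n, ‖a n‖ := tsum_nonneg fun _ => norm_nonneg _
  have hT : 0 ≤ ∑' n, ‖lam n‖ := tsum_nonneg fun _ => norm_nonneg _
  generalize ∑' n, ‖lam n‖ = t at *
  generalize ∑' n, ‖a n‖ = S at *
  generalize ∑' n, ‖b n‖ = β at *
  have : t * β ≤ 1 / 2 * (1 / 2 * S) := by
    calc t * β ≤ t * (t * S) := by gcongr
      _ ≤ 1 / 2 * (1 / 2 * S) := by gcongr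
  have : 0 ≤ ‖a 0‖ := norm_nonneg _
  linarith

theorem tsum_norm_b_le_of_small (h : IsMarchenkoSolution lam a b) (ht : ∑' n, ‖lam n‖ ≤ 1 / 2) :
    ∑' n, ‖b n‖ ≤ 2 * (∑' n, ‖lam n‖) * ‖a 0‖ := by
  have hT : 0 ≤ ∑' n, ‖lam n‖ := tsum_nonneg fun _ => norm_nonneg _
  calc _ ≤ (∑' n, ‖lam n‖) * ∑' n, ‖a n‖ := h.tsum_norm_b_le
    _ ≤ (∑' n, ‖lam n‖) * (2 * ‖a 0‖) := by gcongr; exact h.tsum_norm_a_le ht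
    _ = _ := by ring

theorem tsum_norm_a_succ_le_of_small (h : IsMarchenkoSolution lam a b)
    (ht : ∑' n, ‖lam n‖ ≤ 1 / 2) :
    ∑' n, ‖a (n + 1)‖ ≤ 2 * (∑' n, ‖lam n‖) ^ 2 * ‖a 0‖ := by
  have hT : 0 ≤ ∑' n, ‖lam n‖ := tsum_nonneg fun _ => norm_nonneg _
  calc _ ≤ (∑' n, ‖lam n‖) * ∑' n, ‖b n‖ := h.tsum_norm_a_succ_le
    _ ≤ (∑' n, ‖lam n‖) * (2 * (∑' n, ‖lam n‖) * ‖a 0‖) := by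
      gcongr; exact h.tsum_norm_b_le_of_small ht
    _ = _ := by ring

/-- The outermost pulse strength is, up to a cubic error, the leading entry of the kernel. -/
theorem norm_div_le (h : IsMarchenkoSolution lam a b) (ht : ∑' n, ‖lam n‖ ≤ 1 / 2) :
    ‖b 0 / a 0‖ ≤ ‖lam 0‖ + 2 * (∑' n, ‖lam n‖) ^ 3 := by
  have h0 : 0 < ‖a 0‖ := norm_pos_iff.2 h.ne_zero
  have hT : 0 ≤ ∑' n, ‖lam n‖ := tsum_nonneg fun _ => norm_nonneg _
  have hs := (summable_hankel h.summable_lam h.summable_a 0)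
  simp only [zero_add] at hs
  have hb := h.conj_b 0
  simp only [zero_add] at hb
  have ha1 := (summable_nat_add_iff 1).2 h.summable_a
  rw [norm_div, div_le_iff₀ h0, ← RCLike.norm_conj (b 0), hb, hs.of_norm.tsum_eq_zero_add]
  refine (norm_add_le _ _).trans ?_
  rw [norm_mul, add_mul]
  gcongr
  -- One factor of the kernel norm comes from bounding each `lam (n + 1)` by it, the other two from
  -- the tail of `a`.
  calc ‖∑' n, lam (n + 1) * a (n + 1)‖
      ≤ ∑' n, ‖lam (n + 1) * a (n + 1)‖ := norm_tsum_le_tsum_norm ((summable_nat_add_iff 1).2 hs)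
    _ ≤ ∑' n, (∑' n, ‖lam n‖) * ‖a (n + 1)‖ := by
        refine ((summable_nat_add_iff 1).2 hs).tsum_le_tsum (fun n => ?_) (ha1.mul_left _)
        rw [norm_mul]
        gcongr
        exact h.summable_lam.le_tsum (n + 1) fun _ _ => norm_nonneg _
    _ = (∑' n, ‖lam n‖) * ∑' n, ‖a (n + 1)‖ := tsum_mul_left
    _ ≤ (∑' n, ‖lam n‖) * (2 * (∑' n, ‖lam n‖) ^ 2 * ‖a 0‖) := by
        gcongr; exact h.tsum_norm_a_succ_le_of_small ht
    _ = _ := by ring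

end IsMarchenkoSolution

/-- The coefficients of `(A, B / z)` after stripping `k` pulses. -/
noncomputable def stripped (a b : ℕ → ℂ) : ℕ → (ℕ → ℂ) × (ℕ → ℂ)
  | 0 => (a, b)
  | k + 1 => (stripA (stripped a b k).1 (stripped a b k).2,
      stripB (stripped a b k).1 (stripped a b k).2)

/-- The pulse parameter `tan (|ω| / 2)` times a phase, read off after stripping `k` pulses. -/
noncomputable def strippedParam (a b : ℕ → ℂ) (k : ℕ) : ℂ :=
  (stripped a b k).2 0 / (stripped a b k).1 0

theorem IsMarchenkoSolution.stripped {lam a b : ℕ → ℂ} (h : IsMarchenkoSolution lam a b) (k : ℕ) :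
    IsMarchenkoSolution (fun n => lam (n + k)) (stripped a b k).1 (stripped a b k).2 := by
  induction k with
  | zero => exact h
  | succ k ih =>
    have e : (fun n => lam (n + (k + 1))) = fun n => lam (n + 1 + k) := by
      funext n; congr 1; ring
    rw [e]
    exact ih.strip

theorem tendsto_tsum_norm_tail {lam : ℕ → ℂ} :
    Tendsto (fun k => ∑' n, ‖lam (n + k)‖) atTop (𝓝 0) :=
  tendsto_sum_nat_add fun n => ‖lam n‖

theorem IsMarchenkoSolution.summable_strippedParam {lam a b : ℕ → ℂ}
    (h : IsMarchenkoSolution lam a b)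
    (hc : Summable fun k => (∑' n, ‖lam (n + k)‖) ^ 3) :
    Summable fun k => ‖strippedParam a b k‖ := by
  have hev : ∀ᶠ k in atTop, ∑' n, ‖lam (n + k)‖ ≤ 1 / 2 :=
    (tendsto_tsum_norm_tail (lam := lam)).eventually_le_const (by norm_num)
  obtain ⟨K, hK⟩ := eventually_atTop.1 hev
  rw [← summable_nat_add_iff K]
  refine Summable.of_nonneg_of_le (fun _ => norm_nonneg _)
    (fun k => (h.stripped (k + K)).norm_div_le (hK _ (Nat.le_add_left _ _))) ?_
  simp only [zero_add]
  exact ((summable_nat_add_iff K).2 h.summable_lam).add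
    (((summable_nat_add_iff K).2 hc).mul_left 2)

/-! ### Decay of `ℓ¹` tails from weighted square summability -/

theorem sum_inv_sq_tail_le (k N : ℕ) :
    ∑ n ∈ Finset.range N, (((n + k : ℕ) : ℝ) + 1)⁻¹ ^ 2 ≤ 2 / ((k : ℝ) + 1) := by
  refine le_trans (le_of_eq ?_) (sum_Ioo_inv_sq_le (α := ℝ) k (N + (k + 1)))
  have : Finset.Ioo k (N + (k + 1)) = Finset.Ico (0 + (k + 1)) (N + (k + 1)) := by
    ext; simp
  rw [this, ← Finset.sum_Ico_add' (fun i : ℕ => ((i : ℝ) ^ 2)⁻¹), Finset.range_eq_Ico]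
  refine Finset.sum_congr rfl fun n _ => ?_
  push_cast
  rw [inv_pow, add_assoc]

/-- Weighted square summability controls the `ℓ¹` tails. -/
theorem tsum_norm_tail_le {lam : ℕ → ℂ}
    (hw : Summable fun n : ℕ => ((n : ℝ) + 1) ^ 2 * ‖lam n‖ ^ 2) (k : ℕ) :
    ∑' n, ‖lam (n + k)‖ ≤
      ((∑' n : ℕ, ((n : ℝ) + 1) ^ 2 * ‖lam n‖ ^ 2) / 2 + 1) / √((k : ℝ) + 1) := by
  set C := ∑' n : ℕ, ((n : ℝ) + 1) ^ 2 * ‖lam n‖ ^ 2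
  have hk : (0 : ℝ) < (k : ℝ) + 1 := by positivity
  have hs : 0 < √((k : ℝ) + 1) := Real.sqrt_pos.2 hk
  set s := √((k : ℝ) + 1)
  have hss : s ^ 2 = (k : ℝ) + 1 := Real.sq_sqrt hk.le
  refine Real.tsum_le_of_sum_range_le (fun _ => norm_nonneg _) fun N => ?_
  -- The arithmetic-geometric inequality, weighted by `s = √(k + 1)` so that after summation both
  -- terms have size `1 / s`.
  have key : ∀ n, ‖lam (n + k)‖ ≤ s⁻¹ / 2 * ((((n + k : ℕ) : ℝ) + 1) ^ 2 * ‖lam (n + k)‖ ^ 2)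
      + s / 2 * (((n + k : ℕ) : ℝ) + 1)⁻¹ ^ 2 := fun n => by
    have hn : (0 : ℝ) < ((n + k : ℕ) : ℝ) + 1 := by positivity
    generalize ((n + k : ℕ) : ℝ) + 1 = y at *
    generalize ‖lam (n + k)‖ = x at *
    have : 0 ≤ s⁻¹ / 2 * (y * x - s * y⁻¹) ^ 2 := by positivity
    have e : s⁻¹ / 2 * (y * x - s * y⁻¹) ^ 2
        = s⁻¹ / 2 * (y ^ 2 * x ^ 2) + s / 2 * y⁻¹ ^ 2 - x := by field_simp; ring
    linarith
  calc ∑ n ∈ Finset.range N, ‖lam (n + k)‖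
      ≤ _ := Finset.sum_le_sum fun n _ => key n
    _ = s⁻¹ / 2 * ∑ n ∈ Finset.range N, ((((n + k : ℕ) : ℝ) + 1) ^ 2 * ‖lam (n + k)‖ ^ 2)
        + s / 2 * ∑ n ∈ Finset.range N, (((n + k : ℕ) : ℝ) + 1)⁻¹ ^ 2 := by
        rw [Finset.sum_add_distrib, Finset.mul_sum, Finset.mul_sum]
    _ ≤ s⁻¹ / 2 * C + s / 2 * (2 / ((k : ℝ) + 1)) := by
        gcongr
        · have h1 := ((summable_nat_add_iff k).2 hw).sum_le_tsum (Finset.range N)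
            fun _ _ => by positivity
          have h2 := hw.sum_add_tsum_nat_add k
          have h3 : 0 ≤ ∑ i ∈ Finset.range k, ((i : ℝ) + 1) ^ 2 * ‖lam i‖ ^ 2 :=
            Finset.sum_nonneg fun _ _ => by positivity
          linarith
        · exact sum_inv_sq_tail_le k N
    _ = _ := by rw [← hss]; field_simp

/-- The tails are `O(k^(-1/2))`, whose cube is of the summable order `k^(-3/2)`. This is why the
cubic error in `IsMarchenkoSolution.norm_div_le` matters: a quadratic one would only give `1 / k`.
-/
theorem summable_cube_tsum_tail {lam : ℕ → ℂ}
    (hw : Summable fun n : ℕ => ((n : ℝ) + 1) ^ 2 * ‖lam n‖ ^ 2) :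
    Summable fun k => (∑' n, ‖lam (n + k)‖) ^ 3 := by
  set C := (∑' n : ℕ, ((n : ℝ) + 1) ^ 2 * ‖lam n‖ ^ 2) / 2 + 1 with hC
  have h1 : Summable fun k : ℕ => (((k + 1 : ℕ) : ℝ) ^ (3 / 2 : ℝ))⁻¹ :=
    (summable_nat_add_iff 1).2 (Real.summable_nat_rpow_inv.2 (by norm_num))
  refine Summable.of_nonneg_of_le (fun _ => pow_nonneg (tsum_nonneg fun _ => norm_nonneg _) 3)
    (fun k => ?_) (h1.mul_left (C ^ 3))
  have h2 : (((k + 1 : ℕ) : ℝ) ^ (3 / 2 : ℝ)) = √((k : ℝ) + 1) ^ 3 := by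
    rw [Real.sqrt_eq_rpow, ← Real.rpow_natCast, ← Real.rpow_mul (by positivity)]
    push_cast
    norm_num
  rw [h2, ← div_eq_mul_inv, ← div_pow]
  exact pow_le_pow_left₀ (tsum_nonneg fun _ => norm_nonneg _) (tsum_norm_tail_le hw k) 3

/-! ### Power series with absolutely summable coefficients on the closed disk -/

/-- The sum of the power series with coefficients `a`. -/
noncomputable def powerSum (a : ℕ → ℂ) (z : ℂ) : ℂ := ∑' n, a n * z ^ n

theorem summable_norm_powerSum {a : ℕ → ℂ} (ha : Summable fun n => ‖a n‖) {z : ℂ} (hz : ‖z‖ ≤ 1) :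
    Summable fun n => ‖a n * z ^ n‖ := by
  refine Summable.of_nonneg_of_le (fun _ => norm_nonneg _) (fun n => ?_) ha
  rw [norm_mul, norm_pow]
  exact mul_le_of_le_one_right (norm_nonneg _) (pow_le_one₀ (norm_nonneg _) hz)

theorem norm_powerSum_le {a : ℕ → ℂ} (ha : Summable fun n => ‖a n‖) {z : ℂ} (hz : ‖z‖ ≤ 1) :
    ‖powerSum a z‖ ≤ ∑' n, ‖a n‖ := by
  refine (norm_tsum_le_tsum_norm (summable_norm_powerSum ha hz)).trans
    ((summable_norm_powerSum ha hz).tsum_le_tsum (fun n => ?_) ha)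
  rw [norm_mul, norm_pow]
  exact mul_le_of_le_one_right (norm_nonneg _) (pow_le_one₀ (norm_nonneg _) hz)

theorem powerSum_eq_add {a : ℕ → ℂ} (ha : Summable fun n => ‖a n‖) {z : ℂ} (hz : ‖z‖ ≤ 1) :
    powerSum a z = a 0 + z * powerSum (fun n => a (n + 1)) z := by
  rw [powerSum, (summable_norm_powerSum ha hz).of_norm.tsum_eq_zero_add, powerSum, ← tsum_mul_left]
  simp only [pow_zero, mul_one]
  congr 1
  exact tsum_congr fun n => by ring

namespace IsMarchenkoSolution

variable {lam a b : ℕ → ℂ}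

theorem powerSum_stripA (h : IsMarchenkoSolution lam a b) {z : ℂ} (hz : ‖z‖ ≤ 1) :
    powerSum (stripA a b) z = powerSum a z + conj (b 0 / a 0) * powerSum b z := by
  have sa := (summable_norm_powerSum h.summable_a hz).of_norm
  have sb := (summable_norm_powerSum h.summable_b hz).of_norm
  simp_rw [powerSum, stripA, add_mul, mul_assoc]
  rw [sa.tsum_add (sb.mul_left _), tsum_mul_left]

/-- The constant term of `B / z - γ A` vanishes for `γ = b 0 / a 0`, so a factor `z` splits off. -/
theorem mul_powerSum_stripB (h : IsMarchenkoSolution lam a b) {z : ℂ} (hz : ‖z‖ ≤ 1) :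
    z * powerSum (stripB a b) z = powerSum b z - b 0 / a 0 * powerSum a z := by
  have ha : Summable fun n => ‖a (n + 1)‖ := (summable_nat_add_iff 1).2 h.summable_a
  have hb : Summable fun n => ‖b (n + 1)‖ := (summable_nat_add_iff 1).2 h.summable_b
  have sa := (summable_norm_powerSum ha hz).of_norm
  have sb := (summable_norm_powerSum hb hz).of_norm
  have e : powerSum (stripB a b) z = powerSum (fun n => b (n + 1)) z
      - b 0 / a 0 * powerSum (fun n => a (n + 1)) z := by
    simp_rw [powerSum, stripB, sub_mul, mul_assoc]
    rw [sb.tsum_sub (sa.mul_left _), tsum_mul_left]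
  rw [e, powerSum_eq_add h.summable_a hz, powerSum_eq_add h.summable_b hz]
  have : b 0 / a 0 * a 0 = b 0 := div_mul_cancel₀ _ h.ne_zero
  linear_combination this

/-- The nonconstant part of the series is at most `‖a 0‖ / 2` on the closed disk. -/
theorem norm_div_le_powerSum (h : IsMarchenkoSolution lam a b) (ht : ∑' n, ‖lam n‖ ≤ 1 / 2)
    {z : ℂ} (hz : ‖z‖ ≤ 1) : ‖a 0‖ / 2 ≤ ‖powerSum a z‖ := by
  have ha1 : Summable fun n => ‖a (n + 1)‖ := (summable_nat_add_iff 1).2 h.summable_a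
  have ha := (norm_powerSum_le ha1 hz).trans (h.tsum_norm_a_succ_le_of_small ht)
  have hT : 0 ≤ ∑' n, ‖lam n‖ := tsum_nonneg fun _ => norm_nonneg _
  generalize ∑' n, ‖lam n‖ = t at *
  rw [powerSum_eq_add h.summable_a hz]
  have h1 := norm_sub_le_norm_add (a 0) (z * powerSum (fun n => a (n + 1)) z)
  have h2 : ‖z * powerSum (fun n => a (n + 1)) z‖ ≤ 1 * (2 * t ^ 2 * ‖a 0‖) := by
    rw [norm_mul]
    exact mul_le_mul hz ha (norm_nonneg _) zero_le_one
  have h3 : t ^ 2 ≤ 1 / 4 := by nlinarith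
  have h4 : t ^ 2 * ‖a 0‖ ≤ 1 / 4 * ‖a 0‖ := mul_le_mul_of_nonneg_right h3 (norm_nonneg _)
  linarith

theorem norm_powerSum_div_le (h : IsMarchenkoSolution lam a b) (ht : ∑' n, ‖lam n‖ ≤ 1 / 2)
    {z : ℂ} (hz : ‖z‖ ≤ 1) :
    ‖z * powerSum b z / powerSum a z‖ ≤ 4 * ∑' n, ‖lam n‖ := by
  have hb := (norm_powerSum_le h.summable_b hz).trans (h.tsum_norm_b_le_of_small ht)
  have hA := h.norm_div_le_powerSum ht hz
  have hT : 0 ≤ ∑' n, ‖lam n‖ := tsum_nonneg fun _ => norm_nonneg _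
  have h0 : 0 < ‖a 0‖ := norm_pos_iff.2 h.ne_zero
  generalize ∑' n, ‖lam n‖ = t at *
  rw [norm_div, div_le_iff₀ (by linarith), norm_mul]
  have h1 : ‖z‖ * ‖powerSum b z‖ ≤ 1 * (2 * t * ‖a 0‖) :=
    mul_le_mul hz hb (norm_nonneg _) zero_le_one
  have h2 : t * (‖a 0‖ / 2) ≤ t * ‖powerSum a z‖ := mul_le_mul_of_nonneg_left hA hT
  linarith

/-- The reflection coefficients of the stripped data tend to zero. -/
theorem tendsto_powerSum_div (h : IsMarchenkoSolution lam a b) {z : ℂ} (hz : ‖z‖ ≤ 1) :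
    Tendsto (fun k => z * powerSum (_root_.stripped a b k).2 z /
      powerSum (_root_.stripped a b k).1 z) atTop (𝓝 0) := by
  have ht := tendsto_tsum_norm_tail (lam := lam)
  have hev : ∀ᶠ k in atTop, ∑' n, ‖lam (n + k)‖ ≤ 1 / 2 := ht.eventually_le_const (by norm_num)
  have ht4 := ht.const_mul 4
  rw [mul_zero] at ht4
  exact squeeze_zero_norm' (hev.mono fun k hk => (h.stripped k).norm_powerSum_div_le hk hz) ht4

theorem eventually_powerSum_ne_zero (h : IsMarchenkoSolution lam a b) {z : ℂ} (hz : ‖z‖ ≤ 1) :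
    ∀ᶠ k in atTop, powerSum (_root_.stripped a b k).1 z ≠ 0 := by
  have ht := tendsto_tsum_norm_tail (lam := lam)
  have hev : ∀ᶠ k in atTop, ∑' n, ‖lam (n + k)‖ ≤ 1 / 2 := ht.eventually_le_const (by norm_num)
  refine hev.mono fun k hk h0 => ?_
  have h1 := (h.stripped k).norm_div_le_powerSum hk hz
  have h2 : 0 < ‖(_root_.stripped a b k).1 0‖ := norm_pos_iff.2 (h.stripped k).ne_zero
  rw [h0, norm_zero] at h1
  linarith

end IsMarchenkoSolution

/-! ### Spinors and the Bloch recursion -/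

/-- The point of the sphere with homogeneous coordinates `(A, B)`; its stereographic projection
is `B / A`. -/
noncomputable def hopf (A B : ℂ) : Fin 3 → ℝ :=
  ![2 * (conj A * B).re / (Complex.normSq A + Complex.normSq B),
    2 * (conj A * B).im / (Complex.normSq A + Complex.normSq B),
    (Complex.normSq A - Complex.normSq B) / (Complex.normSq A + Complex.normSq B)]

/-- The complex parameter `-i e^{i arg c} tan (|c| / 2)` of the pulse `c`. -/
noncomputable def pulseParam (c : ℂ) : ℂ := -Complex.I * (c / ‖c‖) * Real.tan (‖c‖ / 2)

theorem norm_pulseParam {c : ℂ} (hc : ‖c‖ < Real.pi) : ‖pulseParam c‖ = Real.tan (‖c‖ / 2) := by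
  by_cases h : c = 0
  · simp [pulseParam, h]
  · have h1 : 0 < ‖c‖ := norm_pos_iff.2 h
    have h2 : 0 ≤ Real.tan (‖c‖ / 2) :=
      Real.tan_nonneg_of_nonneg_of_le_pi_div_two (by linarith) (by linarith)
    rw [pulseParam, norm_mul, norm_mul, norm_neg, Complex.norm_I, norm_div, Complex.norm_real,
      Complex.norm_real, norm_norm, div_self h1.ne', one_mul, one_mul, Real.norm_of_nonneg h2]

/-- The matrix of a pulse is `√(1 + |γ|²)` times a unitary one. These factors accumulate into the
product whose logarithm is the energy. -/
theorem normSq_add_normSq_step (γ A B : ℂ) :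
    Complex.normSq (A - conj γ * B) + Complex.normSq (B + γ * A)
      = (1 + Complex.normSq γ) * (Complex.normSq A + Complex.normSq B) := by
  simp [Complex.normSq_apply]; ring

theorem normSq_add_pos {A B : ℂ} (h : A ≠ 0 ∨ B ≠ 0) :
    0 < Complex.normSq A + Complex.normSq B := by
  rcases h with h | h
  · exact add_pos_of_pos_of_nonneg (Complex.normSq_pos.2 h) (Complex.normSq_nonneg _)
  · exact add_pos_of_nonneg_of_pos (Complex.normSq_nonneg _) (Complex.normSq_pos.2 h)

theorem precession_eq (w : Circle) (v : Fin 3 → ℝ) :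
    precession w v = ![(w : ℂ).re * v 0 - (w : ℂ).im * v 1,
      (w : ℂ).re * v 1 + (w : ℂ).im * v 0, v 2] := by
  simp [precession]

theorem pulseRotation_eq (c : ℂ) (v : Fin 3 → ℝ) :
    pulseRotation c v =
      ![Real.cos ‖c‖ * v 0 + Real.sin ‖c‖ * (c.im / ‖c‖ * v 2)
          + (1 - Real.cos ‖c‖) * (c.re / ‖c‖ * v 0 + c.im / ‖c‖ * v 1) * (c.re / ‖c‖),
        Real.cos ‖c‖ * v 1 - Real.sin ‖c‖ * (c.re / ‖c‖ * v 2)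
          + (1 - Real.cos ‖c‖) * (c.re / ‖c‖ * v 0 + c.im / ‖c‖ * v 1) * (c.im / ‖c‖),
        Real.cos ‖c‖ * v 2 + Real.sin ‖c‖ * (c.re / ‖c‖ * v 1 - c.im / ‖c‖ * v 0)] := by
  simp only [pulseRotation, cross_apply, Matrix.vec3_dotProduct]
  ext i
  fin_cases i <;> simp [Pi.add_apply, Pi.smul_apply, -Matrix.smul_cons] <;> ring

theorem exists_unit_axis {c : ℂ} (h0 : c ≠ 0) :
    ∃ p q : ℝ, c.re / ‖c‖ = p ∧ c.im / ‖c‖ = q ∧ p ^ 2 + q ^ 2 = 1 := by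
  refine ⟨_, _, rfl, rfl, ?_⟩
  have h1 : ‖c‖ ≠ 0 := norm_ne_zero_iff.2 h0
  have h2 : ‖c‖ ^ 2 = c.re ^ 2 + c.im ^ 2 := by
    rw [Complex.sq_norm, Complex.normSq_apply]; ring
  field_simp
  exact h2.symm

theorem precession_hopf (w : Circle) (A B : ℂ) : precession w (hopf A B) = hopf A (w * B) := by
  have hw : Complex.normSq (w : ℂ) = 1 := Circle.normSq_coe w
  rw [precession_eq]
  ext i
  fin_cases i <;> simp [hopf, hw] <;> ring

/-- The action of `SU(2)` on the sphere, with the cosine of the half angle divided out; the bound by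
`π` keeps that cosine nonzero. Everything becomes rational in `t = tan (|c| / 2)` by the
double-angle formulas. -/
theorem pulseRotation_hopf {c : ℂ} (hc : ‖c‖ < Real.pi) {A B : ℂ} (h : A ≠ 0 ∨ B ≠ 0) :
    pulseRotation c (hopf A B)
      = hopf (A - conj (pulseParam c) * B) (B + pulseParam c * A) := by
  have hN := normSq_add_pos h
  have hstep := normSq_add_normSq_step (pulseParam c) A B
  have hcos : Real.cos (‖c‖ / 2) ≠ 0 :=
    (Real.cos_pos_of_mem_Ioo ⟨by linarith [norm_nonneg c, Real.pi_pos], by linarith⟩).ne'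
  set t := Real.tan (‖c‖ / 2) with ht
  have e1 : Real.cos ‖c‖ = (1 - t ^ 2) / (1 + t ^ 2) := by
    have h1 := Real.cos_sq_add_sin_sq (‖c‖ / 2)
    have h2 := Real.cos_two_mul (‖c‖ / 2)
    rw [mul_div_cancel₀ _ two_ne_zero] at h2
    rw [h2, ht, Real.tan_eq_sin_div_cos]
    field_simp
    linear_combination (2 * Real.cos (‖c‖ / 2) ^ 2) * h1
  have e2 : Real.sin ‖c‖ = 2 * t / (1 + t ^ 2) := by
    have h1 := Real.cos_sq_add_sin_sq (‖c‖ / 2)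
    have h2 := Real.sin_two_mul (‖c‖ / 2)
    rw [mul_div_cancel₀ _ two_ne_zero] at h2
    rw [h2, ht, Real.tan_eq_sin_div_cos]
    field_simp
    linear_combination Real.sin (‖c‖ / 2) * h1
  have ht2 : 1 + t ^ 2 ≠ 0 := by positivity
  by_cases h0 : c = 0
  · subst h0
    simp [pulseRotation, pulseParam]
  obtain ⟨p, q, hp, hq, hpq⟩ := exists_unit_axis h0
  have hγ : pulseParam c = ⟨q * t, -(p * t)⟩ := by
    rw [pulseParam, ← ht]
    apply Complex.ext
    · simp [Complex.div_ofReal_re, Complex.div_ofReal_im, hp, hq]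
    · simp [Complex.div_ofReal_re, Complex.div_ofReal_im, hp, hq]
  have hγ2 : Complex.normSq (pulseParam c) = t ^ 2 := by
    rw [hγ, Complex.normSq_mk]; linear_combination t ^ 2 * hpq
  rw [hγ2] at hstep
  rw [pulseRotation_eq, hopf, hopf, hstep, hp, hq, e1, e2, hγ]
  have hN0 := hN.ne'
  generalize hNdef : Complex.normSq A + Complex.normSq B = N at *
  rw [Complex.normSq_apply, Complex.normSq_apply] at hNdef
  ext i
  fin_cases i
  · simp [Complex.normSq_apply]
    field_simp
    linear_combination t ^ 2 * (A.re * B.re + A.im * B.im) * hpq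
  · simp [Complex.normSq_apply]
    field_simp
    linear_combination t ^ 2 * (A.re * B.im - A.im * B.re) * hpq
  · simp [Complex.normSq_apply]
    field_simp
    linear_combination t ^ 2 * (A.re ^ 2 + A.im ^ 2 - (B.re ^ 2 + B.im ^ 2)) * hpq

/-! ### The Bloch step as a linear isometry -/

theorem pulseRotation_sub (c : ℂ) (u v : Fin 3 → ℝ) :
    pulseRotation c u - pulseRotation c v = pulseRotation c (u - v) := by
  simp only [pulseRotation_eq]
  ext i
  fin_cases i <;> simp <;> ring

/-- With linearity and the analogous fact for `precession`, this makes the distance between two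
solutions of the recursion constant in time. -/
theorem pulseRotation_dotProduct_self (c : ℂ) (v : Fin 3 → ℝ) :
    pulseRotation c v ⬝ᵥ pulseRotation c v = v ⬝ᵥ v := by
  by_cases h0 : c = 0
  · simp [h0, pulseRotation]
  obtain ⟨p, q, hp, hq, hpq⟩ := exists_unit_axis h0
  have hcs := Real.cos_sq_add_sin_sq ‖c‖
  rw [pulseRotation_eq, hp, hq, Matrix.vec3_dotProduct, Matrix.vec3_dotProduct]
  generalize Real.cos ‖c‖ = C at *
  generalize Real.sin ‖c‖ = S at *
  simp only [Matrix.cons_val_zero, Matrix.cons_val_one, Matrix.cons_val]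
  linear_combination (v 0 ^ 2 + v 1 ^ 2 + v 2 ^ 2 - (p * v 0 + q * v 1) ^ 2) * hcs
    + (S ^ 2 * (v 0 ^ 2 + v 1 ^ 2 + v 2 ^ 2)
      + (1 - C) ^ 2 * (p * v 0 + q * v 1) ^ 2) * hpq

theorem precession_sub (w : Circle) (u v : Fin 3 → ℝ) :
    precession w u - precession w v = precession w (u - v) := by
  simp only [precession_eq]
  ext i
  fin_cases i <;> simp <;> ring

theorem precession_dotProduct_self (w : Circle) (v : Fin 3 → ℝ) :
    precession w v ⬝ᵥ precession w v = v ⬝ᵥ v := by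
  have hw : Complex.normSq (w : ℂ) = 1 := Circle.normSq_coe w
  rw [Complex.normSq_apply] at hw
  rw [precession_eq, Matrix.vec3_dotProduct, Matrix.vec3_dotProduct]
  simp only [Matrix.cons_val_zero, Matrix.cons_val_one, Matrix.cons_val]
  linear_combination (v 0 ^ 2 + v 1 ^ 2) * hw

theorem precession_precession (w w' : Circle) (v : Fin 3 → ℝ) :
    precession w (precession w' v) = precession (w * w') v := by
  simp only [precession_eq]
  ext i
  fin_cases i <;> simp <;> ring

theorem precession_one (v : Fin 3 → ℝ) : precession 1 v = v := by
  rw [precession_eq]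
  ext i
  fin_cases i <;> simp

/-! ### Homogeneous coordinates and stereographic projection -/

theorem hopf_smul {k : ℂ} (hk : k ≠ 0) (A B : ℂ) : hopf (k * A) (k * B) = hopf A B := by
  have h : Complex.normSq k ≠ 0 := (Complex.normSq_pos.2 hk).ne'
  have e : conj (k * A) * (k * B) = (Complex.normSq k : ℂ) * (conj A * B) := by
    rw [map_mul, Complex.normSq_eq_conj_mul_self]; ring
  rw [hopf, hopf, e, Complex.re_ofReal_mul, Complex.im_ofReal_mul, map_mul, map_mul, ← mul_add,
    ← mul_sub, mul_div_mul_left _ _ h, mul_left_comm, mul_left_comm 2 (Complex.normSq k),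
    mul_div_mul_left _ _ h, mul_div_mul_left _ _ h]

theorem hopf_eq_hopf_one {A : ℂ} (hA : A ≠ 0) (B : ℂ) : hopf A B = hopf 1 (B / A) := by
  rw [← hopf_smul hA 1 (B / A), mul_one, mul_div_cancel₀ _ hA]

theorem hopf_one_zero : hopf 1 0 = ![0, 0, 1] := by
  simp [hopf]

theorem reflection_hopf_one (r : ℂ) :
    ((hopf 1 r 0 : ℂ) + Complex.I * (hopf 1 r 1 : ℂ)) / (1 + (hopf 1 r 2 : ℂ)) = r := by
  have h : (1 + Complex.normSq r : ℝ) ≠ 0 := by have := Complex.normSq_nonneg r; positivity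
  have h' : (1 + Complex.normSq r : ℂ) ≠ 0 := by exact_mod_cast h
  have e : 1 + (1 - (Complex.normSq r : ℂ)) / (1 + Complex.normSq r) ≠ 0 := by
    have : 1 + (1 - (Complex.normSq r : ℂ)) / (1 + Complex.normSq r)
      = 2 / (1 + Complex.normSq r) := by field_simp; ring
    rw [this]
    exact div_ne_zero two_ne_zero h'
  simp only [hopf, map_one, one_mul, Matrix.cons_val_zero, Matrix.cons_val_one, Matrix.cons_val]
  push_cast
  rw [div_eq_iff e]
  field_simp
  linear_combination 2 * Complex.re_add_im r

/-- If `A = 0` the point is the south pole, which no `hopf 1 r` attains; otherwise stereographic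
projection recovers the ratio. -/
theorem hopf_eq_hopf_one_iff {A B r : ℂ} (h0 : A ≠ 0 ∨ B ≠ 0) (h : hopf A B = hopf 1 r) :
    A ≠ 0 ∧ B / A = r := by
  have hA : A ≠ 0 := by
    rintro rfl
    have hB : Complex.normSq B ≠ 0 := (Complex.normSq_pos.2 (by simpa using h0)).ne'
    have hr : (1 + Complex.normSq r : ℝ) ≠ 0 := by have := Complex.normSq_nonneg r; positivity
    have h2 := congrFun h 2
    simp [hopf] at h2
    field_simp at h2
    norm_num at h2
    linarith
  refine ⟨hA, ?_⟩
  rw [hopf_eq_hopf_one hA] at h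
  rw [← reflection_hopf_one (B / A), h, reflection_hopf_one]

/-- Inverse stereographic projection from the south pole; unit length enters as `1 + |r|² = 2 / (1 +
M_z)`. -/
theorem eq_hopf_one_reflectionCoeff (M : Circle → Fin 3 → ℝ) (w : Circle) (hM : M w ⬝ᵥ M w = 1)
    (hz : M w 2 ≠ -1) : M w = hopf 1 (reflectionCoeff M w) := by
  have hz' : 1 + M w 2 ≠ 0 := fun h => hz (by linarith)
  rw [Matrix.vec3_dotProduct] at hM
  have er : reflectionCoeff M w = ⟨M w 0 / (1 + M w 2), M w 1 / (1 + M w 2)⟩ := by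
    have : (1 + (M w 2 : ℂ)) = ((1 + M w 2 : ℝ) : ℂ) := by push_cast; rfl
    rw [reflectionCoeff, this]
    apply Complex.ext
    · rw [Complex.div_ofReal_re]; simp
    · rw [Complex.div_ofReal_im]; simp
  have en : 1 + Complex.normSq (reflectionCoeff M w) = 2 / (1 + M w 2) := by
    rw [er, Complex.normSq_mk]
    field_simp
    linear_combination hM
  have en' : 1 - Complex.normSq (reflectionCoeff M w) = 2 * M w 2 / (1 + M w 2) := by
    have : 1 - Complex.normSq (reflectionCoeff M w)
      = 2 - (1 + Complex.normSq (reflectionCoeff M w)) := by ring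
    rw [this, en]
    field_simp
    ring
  rw [hopf, map_one, map_one, en, en', er]
  ext i
  fin_cases i <;> simp <;> field_simp

theorem Filter.Tendsto.hopf {ι : Type*} {l : Filter ι} {f g : ι → ℂ} {A B : ℂ}
    (hf : Tendsto f l (𝓝 A)) (hg : Tendsto g l (𝓝 B)) (h : A ≠ 0 ∨ B ≠ 0) :
    Tendsto (fun i => hopf (f i) (g i)) l (𝓝 (hopf A B)) := by
  have hN := (normSq_add_pos h).ne'
  have hc : Tendsto (fun i => conj (f i) * g i) l (𝓝 (conj A * B)) :=
    ((Complex.continuous_conj.tendsto _).comp hf).mul hg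
  have hre := ((Complex.continuous_re.tendsto _).comp hc).const_mul 2
  have him := ((Complex.continuous_im.tendsto _).comp hc).const_mul 2
  have hnf := (Complex.continuous_normSq.tendsto _).comp hf
  have hng := (Complex.continuous_normSq.tendsto _).comp hg
  have hsum := hnf.add hng
  rw [tendsto_pi_nhds]
  intro i
  fin_cases i
  · exact hre.div hsum hN
  · exact him.div hsum hN
  · exact (hnf.sub hng).div hsum hN

/-! ### The Sobolev space `H¹` of the circle through difference quotients -/

instance fact_two_pi_pos : Fact (0 < 2 * Real.pi) := ⟨Real.two_pi_pos⟩

/-- The circle of length `2π`. -/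
abbrev AngleCircle : Type := AddCircle (2 * Real.pi)

/-- The point `exp (i x)` of the unit circle in `ℂ`. -/
noncomputable abbrev unitPoint (x : AngleCircle) : ℂ := (AddCircle.toCircle x : ℂ)

theorem continuous_unitPoint : Continuous unitPoint :=
  continuous_subtype_val.comp AddCircle.continuous_toCircle

theorem norm_unitPoint (x : AngleCircle) : ‖unitPoint x‖ = 1 := Circle.norm_coe _

theorem fourier_eq_unitPoint_zpow (n : ℤ) (x : AngleCircle) : fourier n x = unitPoint x ^ n := by
  rw [fourier_apply, AddCircle.toCircle_zsmul]
  simp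

theorem unitPoint_coe (θ : ℝ) : unitPoint (θ : AngleCircle) = circleMap 0 1 θ := by
  rw [unitPoint, AddCircle.toCircle_apply_mk, Circle.coe_exp, circleMap]
  have := Real.pi_ne_zero
  simp

theorem hasSum_sq_fourierCoeff_of_continuous {f : AngleCircle → ℂ} (hf : Continuous f) :
    HasSum (fun n => ‖fourierCoeff f n‖ ^ 2) (∫ x, ‖f x‖ ^ 2 ∂AddCircle.haarAddCircle) := by
  set F : C(AngleCircle, ℂ) := ⟨f, hf⟩
  have h := hasSum_sq_fourierCoeff (ContinuousMap.toLp (E := ℂ) 2 AddCircle.haarAddCircle ℂ F)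
  simp_rw [fourierCoeff_toLp] at h
  have e : ∫ x, ‖f x‖ ^ 2 ∂AddCircle.haarAddCircle = ∫ x, ‖(ContinuousMap.toLp (E := ℂ) 2
      AddCircle.haarAddCircle ℂ F) x‖ ^ 2 ∂AddCircle.haarAddCircle := by
    refine integral_congr_ae ?_
    filter_upwards [ContinuousMap.coeFn_toLp (p := 2) (E := ℂ) (𝕜 := ℂ)
      (AddCircle.haarAddCircle (T := 2 * Real.pi)) F] with x hx
    rw [hx]; rfl
  rw [e]
  exact h

theorem integrable_of_continuous {E : Type*} [NormedAddCommGroup E] {f : AngleCircle → E}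
    (hf : Continuous f) : Integrable f AddCircle.haarAddCircle :=
  hf.integrable_of_hasCompactSupport (HasCompactSupport.of_compactSpace f)

theorem fourierCoeff_add_of_continuous {f g : AngleCircle → ℂ} (hf : Continuous f)
    (hg : Continuous g) (n : ℤ) :
    fourierCoeff (fun x => f x + g x) n = fourierCoeff f n + fourierCoeff g n :=
  congrFun (fourierCoeff.add (integrable_of_continuous hf) (integrable_of_continuous hg)) n

theorem fourierCoeff_sub_of_continuous {f g : AngleCircle → ℂ} (hf : Continuous f)
    (hg : Continuous g) (n : ℤ) :
    fourierCoeff (fun x => f x - g x) n = fourierCoeff f n - fourierCoeff g n := by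
  have h := fourierCoeff_add_of_continuous hf (hg.const_smul (-1 : ℂ)) n
  have e := fourierCoeff.const_smul g (-1 : ℂ) n
  rw [e] at h
  simpa [sub_eq_add_neg] using h

theorem fourierCoeff_conj (f : AngleCircle → ℂ) (n : ℤ) :
    fourierCoeff (fun x => conj (f x)) n = conj (fourierCoeff f (-n)) := by
  rw [fourierCoeff, fourierCoeff, ← integral_conj]
  refine integral_congr_ae (Eventually.of_forall fun x => ?_)
  simp only [smul_eq_mul, map_mul, ← fourier_neg, neg_neg]

theorem fourierCoeff_translate (f : AngleCircle → ℂ) (h : AngleCircle) (n : ℤ) :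
    fourierCoeff (fun x => f (x + h)) n = fourier n h * fourierCoeff f n := by
  rw [fourierCoeff, fourierCoeff, ← integral_const_mul,
    ← integral_add_right_eq_self (fun x => fourier n h * fourier (-n) x • f x) h]
  refine integral_congr_ae (Eventually.of_forall fun x => ?_)
  simp only [smul_eq_mul, fourier_eq_unitPoint_zpow, unitPoint, AddCircle.toCircle_add,
    Circle.coe_mul]
  have h1 : (AddCircle.toCircle h : ℂ) ≠ 0 := Circle.coe_ne_zero _
  rw [mul_zpow, zpow_neg (AddCircle.toCircle h : ℂ)]
  field_simp

/-- Continuous functions in `H¹` of the circle, characterized by difference quotients. -/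
structure IsSobolevCircle (f : AngleCircle → ℂ) : Prop where
  continuous : Continuous f
  bound : ∃ C : ℝ, ∀ h : ℝ,
    ∫ x, ‖f (x + (h : AngleCircle)) - f x‖ ^ 2 ∂AddCircle.haarAddCircle ≤ C * h ^ 2

theorem hasSum_sq_fourierCoeff_translate_sub {f : AngleCircle → ℂ} (hf : Continuous f)
    (h : AngleCircle) :
    HasSum (fun n => ‖fourier n h - 1‖ ^ 2 * ‖fourierCoeff f n‖ ^ 2)
      (∫ x, ‖f (x + h) - f x‖ ^ 2 ∂AddCircle.haarAddCircle) := by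
  have h1 : Continuous fun x => f (x + h) := hf.comp (continuous_add_const h)
  have h2 : Continuous fun x => f (x + h) - f x := h1.sub hf
  convert hasSum_sq_fourierCoeff_of_continuous h2 using 2 with n
  rw [fourierCoeff_sub_of_continuous h1 hf, fourierCoeff_translate, ← mul_pow, ← norm_mul, sub_mul,
    one_mul]

theorem fourier_coe_eq_exp (n : ℤ) (h : ℝ) :
    fourier n (h : AngleCircle) = Complex.exp (Complex.I * ((n * h : ℝ) : ℂ)) := by
  rw [fourier_coe_apply]
  congr 1
  have : (Real.pi : ℂ) ≠ 0 := by exact_mod_cast Real.pi_ne_zero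
  push_cast
  field_simp

theorem norm_fourier_coe_sub_one_le (n : ℤ) (h : ℝ) :
    ‖fourier n (h : AngleCircle) - 1‖ ^ 2 ≤ (n : ℝ) ^ 2 * h ^ 2 := by
  rw [fourier_coe_eq_exp, ← mul_pow, ← sq_abs ((n : ℝ) * h)]
  exact pow_le_pow_left₀ (norm_nonneg _) (Real.norm_exp_I_mul_ofReal_sub_one_le) 2

/-- Parseval for `f (x + h) - f x`, divided by `h²`, bounds every finite sum uniformly; letting `h →
0` turns `|e^{inh} - 1|² / h²` into `n²`. -/
theorem IsSobolevCircle.summable {f : AngleCircle → ℂ} (hf : IsSobolevCircle f) :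
    Summable fun n : ℤ => (n : ℝ) ^ 2 * ‖fourierCoeff f n‖ ^ 2 := by
  obtain ⟨C, hC⟩ := hf.bound
  refine summable_of_sum_le (c := C) (fun n => by positivity) fun s => ?_
  have hlim : ∀ n : ℤ, Tendsto (fun h : ℝ => ‖h⁻¹ • (fourier n (h : AngleCircle) - 1)‖ ^ 2)
      (𝓝[≠] 0) (𝓝 ((n : ℝ) ^ 2)) := fun n => by
    have h1 := (hasDerivAt_fourier (2 * Real.pi) n 0).tendsto_slope_zero
    have h2 := (h1.norm).pow 2
    simp only [zero_add, QuotientAddGroup.mk_zero, fourier_eval_zero, mul_one] at h2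
    convert h2 using 2
    have := Real.pi_pos
    simp [abs_of_pos this]
  have h2 : Tendsto (fun h : ℝ => ∑ n ∈ s, ‖h⁻¹ • (fourier n (h : AngleCircle) - 1)‖ ^ 2
      * ‖fourierCoeff f n‖ ^ 2) (𝓝[≠] 0) (𝓝 (∑ n ∈ s, (n : ℝ) ^ 2 * ‖fourierCoeff f n‖ ^ 2)) :=
    tendsto_finsetSum s fun n _ => (hlim n).mul_const _
  refine le_of_tendsto h2 ?_
  filter_upwards [self_mem_nhdsWithin] with h (hh : h ≠ 0)
  have h3 := hasSum_sq_fourierCoeff_translate_sub hf.continuous (h : AngleCircle)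
  have h4 := (sum_le_hasSum s (fun n _ => by positivity) h3).trans (hC h)
  have e : ∀ n, ‖h⁻¹ • (fourier n (h : AngleCircle) - 1)‖ ^ 2 * ‖fourierCoeff f n‖ ^ 2
      = (h ^ 2)⁻¹ * (‖fourier n (h : AngleCircle) - 1‖ ^ 2 * ‖fourierCoeff f n‖ ^ 2) := fun n => by
    rw [norm_smul, norm_inv, Real.norm_eq_abs, mul_pow, inv_pow, sq_abs, mul_assoc]
  simp_rw [e]
  rw [← Finset.mul_sum, inv_mul_le_iff₀ (by positivity)]
  linarith

theorem isSobolevCircle_of_summable {f : AngleCircle → ℂ} (hf : Continuous f)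
    (hs : Summable fun n : ℤ => (n : ℝ) ^ 2 * ‖fourierCoeff f n‖ ^ 2) : IsSobolevCircle f := by
  refine ⟨hf, ∑' n : ℤ, (n : ℝ) ^ 2 * ‖fourierCoeff f n‖ ^ 2, fun h => ?_⟩
  rw [← tsum_mul_right]
  refine hasSum_le (fun n => ?_) (hasSum_sq_fourierCoeff_translate_sub hf (h : AngleCircle))
    (hs.mul_right _).hasSum
  have := mul_le_mul_of_nonneg_right (norm_fourier_coe_sub_one_le n h)
    (sq_nonneg ‖fourierCoeff f n‖)
  linarith

theorem summable_fourierCoeff_of_weighted {c : ℤ → ℂ}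
    (hs : Summable fun n : ℤ => (n : ℝ) ^ 2 * ‖c n‖ ^ 2) : Summable fun n => ‖c n‖ := by
  have h2 : Summable fun n : ℤ => 1 / (n : ℝ) ^ 2 :=
    Real.summable_one_div_int_pow.2 one_lt_two
  -- The weight `n²` gives no control at `n = 0`, so that coefficient is added separately.
  have h3 : Summable fun n : ℤ => if n = 0 then ‖c 0‖ else 0 :=
    (hasSum_ite_eq 0 ‖c 0‖).summable
  refine Summable.of_nonneg_of_le (fun _ => norm_nonneg _) (fun n => ?_) ((hs.add h2).add h3)
  by_cases hn : n = 0
  · subst hn; simp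
  · have hn' : (n : ℝ) ≠ 0 := by exact_mod_cast hn
    rw [if_neg hn, add_zero, ← mul_pow, one_div, ← inv_pow, ← sq_abs ((n : ℝ)⁻¹), abs_inv,
      ← sq_abs ((n : ℝ) * _), abs_mul, abs_norm]
    have : ‖c n‖ = (|(n : ℝ)| * ‖c n‖) * |(n : ℝ)|⁻¹ := by
      have := abs_ne_zero.2 hn'
      field_simp
    nlinarith [sq_nonneg (|(n : ℝ)| * ‖c n‖ - |(n : ℝ)|⁻¹), norm_nonneg (c n)]

theorem IsSobolevCircle.summable_fourierCoeff {f : AngleCircle → ℂ} (hf : IsSobolevCircle f) :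
    Summable fun n => ‖fourierCoeff f n‖ :=
  summable_fourierCoeff_of_weighted hf.summable

theorem IsSobolevCircle.hasSum_fourier {f : AngleCircle → ℂ} (hf : IsSobolevCircle f)
    (x : AngleCircle) : HasSum (fun n => fourierCoeff f n * unitPoint x ^ n) (f x) := by
  have := has_pointwise_sum_fourier_series_of_summable (f := ⟨f, hf.continuous⟩)
    hf.summable_fourierCoeff.of_norm x
  simp only [smul_eq_mul, fourier_eq_unitPoint_zpow] at this
  exact this

/-- Stability of `H¹` under Lipschitz operations. -/
theorem IsSobolevCircle.of_lipschitz {f₁ f₂ g : AngleCircle → ℂ} (h₁ : IsSobolevCircle f₁)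
    (h₂ : IsSobolevCircle f₂) (hg : Continuous g) (L : ℝ)
    (hL : ∀ x y, ‖g x - g y‖ ≤ L * (‖f₁ x - f₁ y‖ + ‖f₂ x - f₂ y‖)) : IsSobolevCircle g := by
  obtain ⟨C₁, hC₁⟩ := h₁.bound
  obtain ⟨C₂, hC₂⟩ := h₂.bound
  refine ⟨hg, 2 * L ^ 2 * (C₁ + C₂), fun h => ?_⟩
  have ht : ∀ {f : AngleCircle → ℂ}, Continuous f →
      Integrable (fun x => ‖f (x + (h : AngleCircle)) - f x‖ ^ 2) AddCircle.haarAddCircle :=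
    fun {f} hf => integrable_of_continuous
      (((hf.comp (continuous_add_const (h : AngleCircle))).sub hf).norm.pow 2)
  have hb := fun x => hL (x + (h : AngleCircle)) x
  calc ∫ x, ‖g (x + (h : AngleCircle)) - g x‖ ^ 2 ∂AddCircle.haarAddCircle
      ≤ ∫ x, 2 * L ^ 2 * (‖f₁ (x + (h : AngleCircle)) - f₁ x‖ ^ 2
          + ‖f₂ (x + (h : AngleCircle)) - f₂ x‖ ^ 2) ∂AddCircle.haarAddCircle := by
        refine integral_mono (ht hg) (((ht h₁.continuous).add (ht h₂.continuous)).const_mul _)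
          fun x => ?_
        have h3 := pow_le_pow_left₀ (norm_nonneg _) (hb x) 2
        refine h3.trans ?_
        rw [mul_pow]
        nlinarith [mul_nonneg (sq_nonneg L) (sq_nonneg (‖f₁ (x + (h : AngleCircle)) - f₁ x‖
          - ‖f₂ (x + (h : AngleCircle)) - f₂ x‖))]
    _ = 2 * L ^ 2 * (∫ x, ‖f₁ (x + (h : AngleCircle)) - f₁ x‖ ^ 2 ∂AddCircle.haarAddCircle
          + ∫ x, ‖f₂ (x + (h : AngleCircle)) - f₂ x‖ ^ 2 ∂AddCircle.haarAddCircle) := by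
        rw [integral_const_mul, integral_add (ht h₁.continuous) (ht h₂.continuous)]
    _ ≤ 2 * L ^ 2 * (C₁ * h ^ 2 + C₂ * h ^ 2) := by
        gcongr
        · exact hC₁ h
        · exact hC₂ h
    _ = _ := by ring

theorem isSobolevCircle_fourier (n : ℤ) : IsSobolevCircle fun x => unitPoint x ^ n := by
  have e : (fun x => unitPoint x ^ n) = (fourier n : AngleCircle → ℂ) :=
    funext fun x => (fourier_eq_unitPoint_zpow n x).symm
  rw [e]
  refine isSobolevCircle_of_summable (fourier n).continuous ?_
  rw [fourierCoeff_fourier]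
  refine summable_of_ne_finset_zero (s := {n}) fun m hm => ?_
  simp [Finset.notMem_singleton.1 hm]

theorem exists_norm_le_of_continuous {f : AngleCircle → ℂ} (hf : Continuous f) :
    ∃ C : ℝ, 0 ≤ C ∧ ∀ x, ‖f x‖ ≤ C := by
  obtain ⟨C, hC⟩ := isCompact_univ.exists_bound_of_continuousOn hf.continuousOn
  exact ⟨C, (norm_nonneg _).trans (hC 0 trivial), fun x => hC x trivial⟩

theorem exists_pos_le_norm_of_continuous {f : AngleCircle → ℂ} (hf : Continuous f)
    (h0 : ∀ x, f x ≠ 0) : ∃ δ : ℝ, 0 < δ ∧ ∀ x, δ ≤ ‖f x‖ := by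
  obtain ⟨x₀, -, hx₀⟩ := isCompact_univ.exists_isMinOn ⟨0, trivial⟩ hf.norm.continuousOn
  exact ⟨‖f x₀‖, norm_pos_iff.2 (h0 x₀), fun x => hx₀ (Set.mem_univ x)⟩

namespace IsSobolevCircle

variable {f g : AngleCircle → ℂ}

theorem const (c : ℂ) : IsSobolevCircle fun _ => c :=
  ⟨continuous_const, 0, fun h => by simp⟩

theorem mul (hf : IsSobolevCircle f) (hg : IsSobolevCircle g) :
    IsSobolevCircle fun x => f x * g x := by
  obtain ⟨C, hC0, hC⟩ := exists_norm_le_of_continuous hf.continuous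
  obtain ⟨D, hD0, hD⟩ := exists_norm_le_of_continuous hg.continuous
  refine of_lipschitz hf hg (hf.continuous.mul hg.continuous) (C + D) fun x y => ?_
  have e : f x * g x - f y * g y = (f x - f y) * g x + f y * (g x - g y) := by ring
  rw [e]
  refine (norm_add_le _ _).trans ?_
  rw [norm_mul, norm_mul]
  have h1 : ‖f x - f y‖ * ‖g x‖ ≤ ‖f x - f y‖ * D := by gcongr; exact hD x
  have h2 : ‖f y‖ * ‖g x - g y‖ ≤ C * ‖g x - g y‖ := by gcongr; exact hC y
  nlinarith [norm_nonneg (f x - f y), norm_nonneg (g x - g y)]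

theorem add (hf : IsSobolevCircle f) (hg : IsSobolevCircle g) :
    IsSobolevCircle fun x => f x + g x :=
  of_lipschitz hf hg (hf.continuous.add hg.continuous) 1 fun x y => by
    rw [add_sub_add_comm, one_mul]; exact norm_add_le _ _

theorem sub (hf : IsSobolevCircle f) (hg : IsSobolevCircle g) :
    IsSobolevCircle fun x => f x - g x :=
  of_lipschitz hf hg (hf.continuous.sub hg.continuous) 1 fun x y => by
    rw [sub_sub_sub_comm, one_mul]; exact norm_sub_le _ _

theorem star (hf : IsSobolevCircle f) : IsSobolevCircle fun x => conj (f x) :=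
  of_lipschitz hf hf (Complex.continuous_conj.comp hf.continuous) 1 fun x y => by
    rw [← map_sub, RCLike.norm_conj, one_mul]; linarith [norm_nonneg (f x - f y)]

/-- By compactness the values stay away from zero, and inversion is Lipschitz there. -/
theorem inv (hf : IsSobolevCircle f) (h0 : ∀ x, f x ≠ 0) : IsSobolevCircle fun x => (f x)⁻¹ := by
  obtain ⟨δ, hδ, hb⟩ := exists_pos_le_norm_of_continuous hf.continuous h0
  refine of_lipschitz hf hf (hf.continuous.inv₀ h0) (δ ^ 2)⁻¹ fun x y => ?_
  rw [inv_sub_inv (h0 x) (h0 y), norm_div, norm_mul, div_eq_inv_mul, norm_sub_rev (f y)]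
  have h1 : δ ^ 2 ≤ ‖f x‖ * ‖f y‖ := by
    rw [sq]; exact mul_le_mul (hb x) (hb y) hδ.le (norm_nonneg _)
  gcongr
  linarith [norm_nonneg (f x - f y)]

theorem cexp (hf : IsSobolevCircle f) : IsSobolevCircle fun x => Complex.exp (f x) := by
  obtain ⟨C, hC0, hC⟩ := exists_norm_le_of_continuous hf.continuous
  refine of_lipschitz hf hf (Complex.continuous_exp.comp hf.continuous) (Real.exp C)
    fun x y => ?_
  have h1 : ‖Complex.exp (f x) - Complex.exp (f y)‖ ≤ Real.exp C * ‖f x - f y‖ := by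
    refine (convex_closedBall (0 : ℂ) C).norm_image_sub_le_of_norm_deriv_le
      (fun z _ => Complex.differentiableAt_exp) (fun z hz => ?_) ?_ ?_
    · rw [Complex.deriv_exp, Complex.norm_exp]
      exact Real.exp_le_exp.2 ((Complex.re_le_norm z).trans (by simpa using hz))
    · simpa using hC y
    · simpa using hC x
  refine h1.trans ?_
  gcongr
  linarith [norm_nonneg (f x - f y)]

/-- The logarithm of a positive function whose values, as complex numbers, are in `H¹`. -/
theorem log {u : AngleCircle → ℝ} (hu : IsSobolevCircle fun x => (u x : ℂ)) (h0 : ∀ x, 0 < u x) :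
    IsSobolevCircle fun x => (Real.log (u x) : ℂ) := by
  obtain ⟨δ, hδ, hb⟩ := exists_pos_le_norm_of_continuous hu.continuous
    fun x => by exact_mod_cast (h0 x).ne'
  have huc : Continuous u := Complex.continuous_re.comp hu.continuous
  have hb' : ∀ x, δ ≤ u x := fun x => by
    simpa [abs_of_pos (h0 x)] using hb x
  refine of_lipschitz hu hu
    (Complex.continuous_ofReal.comp (huc.log fun x => (h0 x).ne')) δ⁻¹ fun x y => ?_
  rw [← Complex.ofReal_sub, ← Complex.ofReal_sub, Complex.norm_real, Complex.norm_real]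
  have h1 : ‖Real.log (u x) - Real.log (u y)‖ ≤ δ⁻¹ * ‖u x - u y‖ := by
    refine (convex_Ici δ).norm_image_sub_le_of_norm_deriv_le
      (fun z hz => Real.differentiableAt_log (hδ.trans_le hz).ne') (fun z hz => ?_) (hb' y) (hb' x)
    have hz' : 0 < z := hδ.trans_le hz
    rw [Real.deriv_log, norm_inv, Real.norm_of_nonneg hz'.le]
    exact inv_anti₀ hδ hz
  refine h1.trans ?_
  gcongr
  linarith [norm_nonneg (u x - u y)]

theorem polynomial (p : Polynomial ℂ) : IsSobolevCircle fun x => p.eval (unitPoint x) := by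
  induction p using Polynomial.induction_on' with
  | add p q hp hq => simpa using hp.add hq
  | monomial n a =>
    have := (const a).mul (isSobolevCircle_fourier (n : ℤ))
    simpa using this

end IsSobolevCircle

/-- Testing the weak derivative `g` against `e^{-inθ}` gives `ĝ(n) = i n f̂(n)`; then Parseval
applies to `g`. -/
theorem summable_weighted_of_memSobolevH1 {f : Circle → ℂ} (hf : MemSobolevH1 f) :
    Summable fun n : ℤ =>
      (n : ℝ) ^ 2 * ‖fourierCoeff (fun x : AngleCircle => f (AddCircle.toCircle x)) n‖ ^ 2 := by
  obtain ⟨-, g, hg, hfg⟩ := hf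
  have hsum := (hasSum_sq_fourierCoeffOn Real.two_pi_pos hg).summable
  refine hsum.congr fun n => ?_
  have hpi : (Real.pi : ℂ) ≠ 0 := by exact_mod_cast Real.pi_ne_zero
  set φ : ℝ → ℂ := fun θ => Complex.exp (-(n : ℂ) * Complex.I * θ) with hφ
  have hd : ∀ θ, deriv φ θ = -(n : ℂ) * Complex.I * φ θ := fun θ => by
    have h1 : HasDerivAt (fun θ : ℝ => -(n : ℂ) * Complex.I * (θ : ℂ)) (-(n : ℂ) * Complex.I) θ := by
      simpa using (Complex.ofRealCLM.hasDerivAt (x := θ)).const_mul (-(n : ℂ) * Complex.I)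
    rw [h1.cexp.deriv, mul_comm]
  have hsm : ContDiff ℝ (⊤ : ℕ∞) φ :=
    (contDiff_const.mul Complex.ofRealCLM.contDiff).cexp
  have hper : Function.Periodic φ (2 * Real.pi) := fun θ => by
    simp only [hφ]
    rw [Complex.exp_eq_exp_iff_exists_int]
    exact ⟨-n, by push_cast; ring⟩
  have key := hfg φ hsm hper
  have e1 : fourierCoeff (fun x : AngleCircle => f (AddCircle.toCircle x)) n
      = (1 / (2 * Real.pi)) • ∫ θ in (0 : ℝ)..(2 * Real.pi), f (Circle.exp θ) * φ θ := by
    rw [fourierCoeff_eq_intervalIntegral _ n 0, zero_add]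
    congr 1
    refine intervalIntegral.integral_congr fun θ _ => ?_
    simp only [smul_eq_mul, fourier_coe_apply, AddCircle.toCircle_apply_mk, hφ]
    rw [mul_comm, div_self (by positivity), one_mul]
    congr 2
    push_cast
    field_simp
  have e2 : fourierCoeffOn Real.two_pi_pos (fun θ : ℝ => g (Circle.exp θ)) n
      = (1 / (2 * Real.pi)) • ∫ θ in (0 : ℝ)..(2 * Real.pi), g (Circle.exp θ) * φ θ := by
    rw [fourierCoeffOn_eq_integral, sub_zero]
    congr 1
    refine intervalIntegral.integral_congr fun θ _ => ?_
    simp only [smul_eq_mul, fourier_coe_apply, hφ]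
    rw [mul_comm]
    congr 2
    push_cast
    field_simp
  have e3 : ∫ θ in (0 : ℝ)..(2 * Real.pi), f (Circle.exp θ) * deriv φ θ
      = -(n : ℂ) * Complex.I * ∫ θ in (0 : ℝ)..(2 * Real.pi), f (Circle.exp θ) * φ θ := by
    rw [← intervalIntegral.integral_const_mul]
    refine intervalIntegral.integral_congr fun θ _ => ?_
    simp only [hd]
    ring
  have e4 : fourierCoeffOn Real.two_pi_pos (fun θ : ℝ => g (Circle.exp θ)) n
      = (n : ℂ) * Complex.I * fourierCoeff (fun x : AngleCircle => f (AddCircle.toCircle x)) n := by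
    rw [e1, e2, mul_smul_comm]
    congr 1
    rw [e3] at key
    linear_combination key
  rw [e4, norm_mul, norm_mul, Complex.norm_I, mul_one, mul_pow, Complex.norm_intCast, sq_abs]

theorem isSobolevCircle_of_memSobolevH1 {f : Circle → ℂ} (hc : Continuous f)
    (hf : MemSobolevH1 f) : IsSobolevCircle fun x => f (AddCircle.toCircle x) :=
  isSobolevCircle_of_summable (hc.comp AddCircle.continuous_toCircle)
    (summable_weighted_of_memSobolevH1 hf)

/-! ### Boundary values of functions in the disk algebra -/

/-- The disk algebra: holomorphic in the open unit disk, continuous up to the boundary. -/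
abbrev IsDiskAlgebra (f : ℂ → ℂ) : Prop := DiffContOnCl ℂ f (Metric.ball 0 1)

theorem IsDiskAlgebra.continuousOn_closedBall {f : ℂ → ℂ} (hf : IsDiskAlgebra f) :
    ContinuousOn f (Metric.closedBall 0 1) := by
  simpa [closure_ball (0 : ℂ) one_ne_zero] using hf.continuousOn

theorem IsDiskAlgebra.continuous_boundary {f : ℂ → ℂ} (hf : IsDiskAlgebra f) :
    Continuous fun x : AngleCircle => f (unitPoint x) :=
  hf.continuousOn_closedBall.comp_continuous continuous_unitPoint
    fun x => by simp [norm_unitPoint]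

theorem IsDiskAlgebra.mul {f g : ℂ → ℂ} (hf : IsDiskAlgebra f) (hg : IsDiskAlgebra g) :
    IsDiskAlgebra fun z => f z * g z := hf.smul hg

theorem isDiskAlgebra_polynomial (p : Polynomial ℂ) : IsDiskAlgebra fun z => p.eval z :=
  p.differentiable.diffContOnCl

/-- The mean value property of `z ^ n * f z`. The factor `0 ^ n` treats the mean `n = 0` and the
vanishing coefficients `n > 0` together. -/
theorem IsDiskAlgebra.fourierCoeff_neg {f : ℂ → ℂ} (hf : IsDiskAlgebra f) (n : ℕ) :
    fourierCoeff (fun x : AngleCircle => f (unitPoint x)) (-n) = 0 ^ n * f 0 := by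
  have h1 : IsDiskAlgebra fun z => z ^ n * f z := by
    simpa using (isDiskAlgebra_polynomial (Polynomial.X ^ n)).mul hf
  have h2 := DiffContOnCl.circleAverage (f := fun z => z ^ n * f z) (c := 0) (R := 1)
    (by simpa using h1)
  rw [← h2, fourierCoeff_eq_intervalIntegral _ _ 0, zero_add, Real.circleAverage_def, one_div]
  congr 1
  refine intervalIntegral.integral_congr fun θ _ => ?_
  simp only [neg_neg, smul_eq_mul, fourier_eq_unitPoint_zpow, unitPoint_coe, zpow_natCast]

theorem IsDiskAlgebra.fourierCoeff_zero {f : ℂ → ℂ} (hf : IsDiskAlgebra f) :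
    fourierCoeff (fun x : AngleCircle => f (unitPoint x)) 0 = f 0 := by
  simpa using hf.fourierCoeff_neg 0

theorem IsDiskAlgebra.fourierCoeff_neg_succ {f : ℂ → ℂ} (hf : IsDiskAlgebra f) (n : ℕ) :
    fourierCoeff (fun x : AngleCircle => f (unitPoint x)) (-((n : ℤ) + 1)) = 0 := by
  simpa using hf.fourierCoeff_neg (n + 1)

theorem IsDiskAlgebra.eq_powerSum {f : ℂ → ℂ} (hf : IsDiskAlgebra f)
    (hs : IsSobolevCircle fun x => f (unitPoint x)) (x : AngleCircle) :
    f (unitPoint x) = powerSum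
      (fun n : ℕ => fourierCoeff (fun x : AngleCircle => f (unitPoint x)) n) (unitPoint x) := by
  have h := hs.hasSum_fourier x
  rw [← (Nat.cast_injective (R := ℤ)).hasSum_iff] at h
  · rw [powerSum, ← h.tsum_eq]
    simp
  · intro m hm
    obtain ⟨n, rfl | rfl⟩ := m.eq_nat_or_neg
    · exact absurd ⟨n, rfl⟩ hm
    · rcases n with _ | n
      · exact absurd ⟨0, by simp⟩ hm
      · have := hf.fourierCoeff_neg_succ n
        push_cast
        simp only [this, zero_mul]

theorem summable_norm_natCast_fourierCoeff {f : AngleCircle → ℂ} (hs : IsSobolevCircle f) :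
    Summable fun n : ℕ => ‖fourierCoeff f n‖ :=
  hs.summable_fourierCoeff.comp_injective (Nat.cast_injective (R := ℤ))

theorem fourierCoeff_unitPoint_pow_mul (g : AngleCircle → ℂ) (k : ℕ) (n : ℤ) :
    ∫ x, fourier (-n) x • (unitPoint x ^ k * g x) ∂AddCircle.haarAddCircle
      = fourierCoeff g (n - k) := by
  rw [fourierCoeff]
  refine integral_congr_ae (Eventually.of_forall fun x => ?_)
  have hx : unitPoint x ≠ 0 := Circle.coe_ne_zero _
  simp only [smul_eq_mul, fourier_eq_unitPoint_zpow]
  rw [neg_sub, sub_eq_add_neg, zpow_add₀ hx, zpow_natCast]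
  ring

/-- Fourier coefficients of the product of an absolutely convergent power series with a
continuous function. -/
theorem fourierCoeff_powerSum_mul {a : ℕ → ℂ} (ha : Summable fun n => ‖a n‖) {g : AngleCircle → ℂ}
    (hg : Continuous g) (n : ℤ) :
    fourierCoeff (fun x => powerSum a (unitPoint x) * g x) n
      = ∑' k : ℕ, a k * fourierCoeff g (n - k) := by
  obtain ⟨C, hC0, hC⟩ := exists_norm_le_of_continuous hg
  set F : ℕ → AngleCircle → ℂ := fun k x => a k * (fourier (-n) x • (unitPoint x ^ k * g x))
  have hFc : ∀ k, Continuous (F k) := fun k =>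
    continuous_const.mul ((fourier (-n)).continuous.smul ((continuous_unitPoint.pow k).mul hg))
  have hFn : ∀ k x, ‖F k x‖ ≤ ‖a k‖ * C := fun k x => by
    simp only [F, smul_eq_mul, norm_mul, norm_pow, norm_unitPoint, fourier_eq_unitPoint_zpow,
      norm_zpow, one_zpow, one_pow, one_mul]
    gcongr
    exact hC x
  have hS : Summable fun k => ∫ x, ‖F k x‖ ∂AddCircle.haarAddCircle := by
    refine Summable.of_nonneg_of_le (fun k => integral_nonneg fun x => norm_nonneg _)
      (fun k => ?_) (ha.mul_right C)
    refine (integral_mono (integrable_of_continuous (hFc k).norm) (integrable_const (‖a k‖ * C))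
      (hFn k)).trans (le_of_eq ?_)
    simp
  have h := hasSum_integral_of_summable_integral_norm
    (fun k => integrable_of_continuous (hFc k)) hS
  rw [fourierCoeff]
  have e : ∀ x, fourier (-n) x • (powerSum a (unitPoint x) * g x) = ∑' k, F k x := fun x => by
    simp only [F, powerSum, smul_eq_mul]
    rw [← tsum_mul_right, ← tsum_mul_left]
    exact tsum_congr fun k => by ring
  simp_rw [e]
  rw [← h.tsum_eq]
  refine tsum_congr fun k => ?_
  simp only [F]
  rw [integral_const_mul, fourierCoeff_unitPoint_pow_mul]

theorem isDiskAlgebra_powerSum {a : ℕ → ℂ} (ha : Summable fun n => ‖a n‖) :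
    IsDiskAlgebra (powerSum a) := by
  have hb : ∀ (n : ℕ) (z : ℂ), z ∈ Metric.closedBall (0 : ℂ) 1 → ‖a n * z ^ n‖ ≤ ‖a n‖ :=
    fun n z hz => by
      rw [norm_mul, norm_pow]
      exact mul_le_of_le_one_right (norm_nonneg _)
        (pow_le_one₀ (norm_nonneg _) (by simpa using hz))
  refine ⟨?_, ?_⟩
  · exact Complex.differentiableOn_tsum_of_summable_norm ha (fun n => by fun_prop)
      Metric.isOpen_ball fun n z hz => hb n z (Metric.ball_subset_closedBall hz)
  · rw [closure_ball (0 : ℂ) one_ne_zero]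
    exact continuousOn_tsum (fun n => by fun_prop) ha hb

theorem powerSum_zero (a : ℕ → ℂ) : powerSum a 0 = a 0 := by
  rw [powerSum, tsum_eq_single 0 fun n hn => by simp [hn]]
  simp

theorem fourierCoeff_powerSum {a : ℕ → ℂ} (ha : Summable fun n => ‖a n‖) (m : ℕ) :
    fourierCoeff (fun x : AngleCircle => powerSum a (unitPoint x)) m = a m := by
  have h := fourierCoeff_powerSum_mul ha (g := fun _ => 1) continuous_const m
  simp only [mul_one] at h
  have h1 : ∀ k : ℤ, fourierCoeff (fun _ : AngleCircle => (1 : ℂ)) k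
      = (Pi.single 0 1 : ℤ → ℂ) k := fun k => by
    rw [← fourierCoeff_fourier (T := 2 * Real.pi)]
    congr 1
    funext x
    rw [fourier_zero]
  rw [h, tsum_eq_single m fun k hk => ?_]
  · simp [h1]
  · rw [h1, Pi.single_eq_of_ne, mul_zero]
    intro h0
    exact hk (by omega)

theorem isSobolevCircle_powerSum {a : ℕ → ℂ} (ha : Summable fun n => ‖a n‖)
    (hw : Summable fun n : ℕ => (n : ℝ) ^ 2 * ‖a n‖ ^ 2) :
    IsSobolevCircle fun x => powerSum a (unitPoint x) := by
  have hd := isDiskAlgebra_powerSum ha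
  refine isSobolevCircle_of_summable hd.continuous_boundary ?_
  rw [← (Nat.cast_injective (R := ℤ)).summable_iff]
  · refine hw.congr fun n => ?_
    simp only [Function.comp, fourierCoeff_powerSum ha, Int.cast_natCast]
  · intro m hm
    obtain ⟨n, rfl | rfl⟩ := m.eq_nat_or_neg
    · exact absurd ⟨n, rfl⟩ hm
    · rcases n with _ | n
      · exact absurd ⟨0, by simp⟩ hm
      · have h1 := hd.fourierCoeff_neg_succ n
        have h2 : (-((n + 1 : ℕ) : ℤ)) = -((n : ℤ) + 1) := by push_cast; ring
        rw [h2, h1, norm_zero]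
        simp

/-! ### Division and Bézout identities in the disk algebra -/

theorem IsDiskAlgebra.dslope {f : ℂ → ℂ} (hf : IsDiskAlgebra f) {a : ℂ}
    (ha : a ∈ Metric.ball (0 : ℂ) 1) : IsDiskAlgebra (dslope f a) := by
  have hn : Metric.ball (0 : ℂ) 1 ∈ 𝓝 a := Metric.isOpen_ball.mem_nhds ha
  refine ⟨(Complex.differentiableOn_dslope hn).2 hf.differentiableOn, ?_⟩
  rw [continuousOn_dslope (mem_of_superset hn subset_closure)]
  exact ⟨hf.continuousOn, hf.differentiableOn.differentiableAt hn⟩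

/-- `f` and the polynomial `Q` generate the unit ideal of the disk algebra, with a polynomial
cofactor of `f`. -/
def HasBezout (f : ℂ → ℂ) (Q : Polynomial ℂ) : Prop :=
  ∃ E : Polynomial ℂ, ∃ D : ℂ → ℂ, IsDiskAlgebra D ∧ ∀ z, E.eval z * f z + D z * Q.eval z = 1

/-- Adding `c Q` to `E` replaces `D` by `D - c f`. With `c = D a / f a` the latter vanishes at `a`,
so it is divisible by `X - a`. -/
theorem HasBezout.mul_X_sub_C {f : ℂ → ℂ} (hf : IsDiskAlgebra f) {Q : Polynomial ℂ}
    (h : HasBezout f Q) {a : ℂ} (ha : a ∈ Metric.ball (0 : ℂ) 1) (h0 : f a ≠ 0) :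
    HasBezout f (Q * (Polynomial.X - Polynomial.C a)) := by
  obtain ⟨E, D, hD, hE⟩ := h
  set c := D a / f a
  have hg : IsDiskAlgebra fun z => D z - c * f z := hD.sub (hf.const_smul c)
  refine ⟨E + Polynomial.C c * Q, _root_.dslope (fun z => D z - c * f z) a, hg.dslope ha,
    fun z => ?_⟩
  have h1 := sub_smul_dslope (fun z => D z - c * f z) a z
  have h2 : D a - c * f a = 0 := by simp [c, h0]
  simp only [h2, sub_zero, smul_eq_mul] at h1
  simp only [Polynomial.eval_add, Polynomial.eval_mul, Polynomial.eval_C, Polynomial.eval_sub,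
    Polynomial.eval_X]
  linear_combination hE z + Q.eval z * h1

theorem hasBezout_prod {f : ℂ → ℂ} (hf : IsDiskAlgebra f) (s : Finset ℂ) (d : ℂ → ℕ)
    (hs : ∀ a ∈ s, a ∈ Metric.ball (0 : ℂ) 1 ∧ f a ≠ 0) :
    HasBezout f (∏ a ∈ s, (Polynomial.X - Polynomial.C a) ^ d a) := by
  classical
  induction s using Finset.induction_on with
  | empty => exact ⟨0, fun _ => 1, diffContOnCl_const, fun z => by simp⟩
  | insert a s ha ih =>
    have h1 := ih fun b hb => hs b (Finset.mem_insert_of_mem hb)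
    have h2 := hs a (Finset.mem_insert_self a s)
    rw [Finset.prod_insert ha, mul_comm]
    generalize d a = n
    induction n with
    | zero => simpa using h1
    | succ n ihn =>
      rw [pow_succ, ← mul_assoc]
      exact ihn.mul_X_sub_C hf h2.1 h2.2

/-! ### Meromorphic functions in the disk with boundary values -/

namespace IsMeromorphicExtension

variable {f : Circle → ℂ} {F : ℂ → ℂ}

/-- Limits taken from the disk at every boundary point vary continuously with the point. This
supplies the continuous representative that `IsSobolevCircle` asks for. -/
theorem continuous (h : IsMeromorphicExtension f F) : Continuous f := by
  have hcl : closure (Metric.ball (0 : ℂ) 1) = Metric.closedBall 0 1 := closure_ball _ one_ne_zero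
  have hsub : Metric.sphere (0 : ℂ) 1 ⊆ closure (Metric.ball (0 : ℂ) 1) := by
    rw [hcl]; exact Metric.sphere_subset_closedBall
  have hc : ContinuousOn (extendFrom (Metric.ball (0 : ℂ) 1) F) (Metric.sphere (0 : ℂ) 1) :=
    continuousOn_extendFrom hsub fun x hx => ⟨_, h.boundary ⟨x, by simpa [Submonoid.unitSphere] using hx⟩⟩
  have hmem : ∀ w : Circle, (w : ℂ) ∈ Metric.sphere (0 : ℂ) 1 := fun w => by
    rw [mem_sphere_zero_iff_norm]; exact Circle.norm_coe w
  have e : f = fun w : Circle => extendFrom (Metric.ball (0 : ℂ) 1) F (w : ℂ) :=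
    funext fun w => (extendFrom_eq (hsub (hmem w)) (h.boundary w)).symm
  rw [e]
  exact hc.comp_continuous continuous_subtype_val hmem

/-- `F` is bounded on the part of the disk near `w`, whereas it is unbounded near each pole. -/
theorem eventually_notMem_diskPoles (h : IsMeromorphicExtension f F) (w : Circle) :
    ∀ᶠ z in 𝓝 (w : ℂ), z ∉ diskPoles F := by
  have h1 : ∀ᶠ z in 𝓝[Metric.ball 0 1] (w : ℂ), ‖F z‖ < ‖f w‖ + 1 :=
    (h.boundary w).norm.eventually_lt_const (by linarith)
  rw [eventually_nhdsWithin_iff, ← eventually_eventually_nhds] at h1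
  filter_upwards [h1] with z hz hp
  have hb : ∀ᶠ y in 𝓝 z, y ∈ Metric.ball (0 : ℂ) 1 := Metric.isOpen_ball.mem_nhds hp.1
  have h2 := tendsto_norm_atTop_iff_cobounded.2 (tendsto_cobounded_of_meromorphicOrderAt_neg hp.2)
  have h3 : ∀ᶠ y in 𝓝[≠] z, ‖F y‖ < ‖f w‖ + 1 :=
    nhdsWithin_le_nhds (hz.and hb |>.mono fun y hy => hy.1 hy.2)
  obtain ⟨y, hy1, hy2⟩ := (h3.and (h2.eventually_ge_atTop (‖f w‖ + 1))).exists
  linarith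

/-- Infinitely many poles would accumulate in the closed disk: inside, this contradicts that poles
are isolated; on the circle, the preceding lemma. -/
theorem finite_diskPoles (h : IsMeromorphicExtension f F) : (diskPoles F).Finite := by
  by_contra hinf
  obtain ⟨x, hx, hacc⟩ := Set.Infinite.exists_accPt_of_subset_isCompact hinf
    (isCompact_closedBall (0 : ℂ) 1) fun z hz => Metric.ball_subset_closedBall hz.1
  rw [accPt_iff_frequently_nhdsNE] at hacc
  rcases (by simpa using hx : ‖x‖ ≤ 1).lt_or_eq with h1 | h1
  · have hxb : x ∈ Metric.ball (0 : ℂ) 1 := by simpa using h1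
    refine hacc ((h.meromorphic x hxb).eventually_analyticAt.mono fun y hy hp => ?_)
    exact absurd hp.2 (not_lt.2 hy.meromorphicOrderAt_nonneg)
  · exact hacc (nhdsWithin_le_nhds
      (h.eventually_notMem_diskPoles ⟨x, by simpa [Submonoid.unitSphere] using h1⟩))

end IsMeromorphicExtension

/-- The polynomial whose zeros are the poles of `F`, with multiplicities. -/
noncomputable def polePoly (F : ℂ → ℂ) (hfin : (diskPoles F).Finite) : Polynomial ℂ :=
  ∏ a ∈ hfin.toFinset, (Polynomial.X - Polynomial.C a) ^ poleMultiplicity F a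

theorem eval_polePoly {F : ℂ → ℂ} (hfin : (diskPoles F).Finite) (z : ℂ) :
    (polePoly F hfin).eval z = ∏ a ∈ hfin.toFinset, (z - a) ^ poleMultiplicity F a := by
  simp [polePoly, Polynomial.eval_prod]

theorem eval_polePoly_ne_zero {F : ℂ → ℂ} (hfin : (diskPoles F).Finite) {z : ℂ}
    (hz : z ∉ diskPoles F) : (polePoly F hfin).eval z ≠ 0 := by
  rw [eval_polePoly]
  refine Finset.prod_ne_zero_iff.2 fun a ha => pow_ne_zero _ (sub_ne_zero.2 ?_)
  rintro rfl
  exact hz (hfin.mem_toFinset.1 ha)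

theorem meromorphicOrderAt_eq_neg_poleMultiplicity {F : ℂ → ℂ} {a : ℂ} (ha : a ∈ diskPoles F) :
    meromorphicOrderAt F a = ((-(poleMultiplicity F a : ℤ) : ℤ) : WithTop ℤ) := by
  obtain ⟨m, hm⟩ := WithTop.ne_top_iff_exists.1 ha.2.ne_top
  have h1 := ha.2
  rw [poleMultiplicity, ← hm, WithTop.untop₀_coe]
  rw [← hm] at h1
  have : m < 0 := by exact_mod_cast h1
  congr 1
  omega

theorem meromorphicOrderAt_polePoly_mul {F : ℂ → ℂ} (hF : MeromorphicOn F (Metric.ball 0 1))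
    (hfin : (diskPoles F).Finite) {a : ℂ} (ha : a ∈ diskPoles F) :
    meromorphicOrderAt (fun z => (polePoly F hfin).eval z * F z) a = 0 := by
  classical
  have hFa := hF a ha.1
  set G : ℂ → ℂ := fun z => ∏ b ∈ hfin.toFinset.erase a, (z - b) ^ poleMultiplicity F b with hG
  have hGa : AnalyticAt ℂ G a :=
    Finset.analyticAt_fun_prod _ fun b _ => (analyticAt_id.sub analyticAt_const).pow _
  have hG0 : G a ≠ 0 := Finset.prod_ne_zero_iff.2 fun b hb =>
    pow_ne_zero _ (sub_ne_zero.2 (Finset.ne_of_mem_erase hb).symm)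
  have e : (fun z => (polePoly F hfin).eval z * F z)
      = G * (((· - a) ^ poleMultiplicity F a : ℂ → ℂ) * F) := by
    funext z
    rw [eval_polePoly, ← Finset.mul_prod_erase _ _ (hfin.mem_toFinset.2 ha)]
    simp only [Pi.mul_apply, Pi.pow_apply, hG]
    ring
  rw [e, meromorphicOrderAt_mul_of_ne_zero hGa hG0, meromorphicOrderAt_mul (by fun_prop) hFa,
    meromorphicOrderAt_pow_id_sub_const, meromorphicOrderAt_eq_neg_poleMultiplicity ha]
  norm_cast
  simp

theorem meromorphicOrderAt_polePoly_mul_nonneg {F : ℂ → ℂ}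
    (hF : MeromorphicOn F (Metric.ball 0 1)) (hfin : (diskPoles F).Finite) {z : ℂ}
    (hz : z ∈ Metric.ball (0 : ℂ) 1) :
    0 ≤ meromorphicOrderAt (fun z => (polePoly F hfin).eval z * F z) z := by
  by_cases h : z ∈ diskPoles F
  · exact (meromorphicOrderAt_polePoly_mul hF hfin h).ge
  · have h1 : AnalyticAt ℂ (fun z => (polePoly F hfin).eval z) z :=
      (polePoly F hfin).differentiable.analyticAt z
    have := meromorphicOrderAt_mul_of_ne_zero (f := F) h1 (eval_polePoly_ne_zero hfin h)
    rw [show (fun z => (polePoly F hfin).eval z * F z)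
      = (fun z => (polePoly F hfin).eval z) * F from rfl, this]
    exact not_lt.1 fun h2 => h ⟨hz, h2⟩

theorem zero_notMem_diskPoles {F : ℂ → ℂ} (hF : MeromorphicOn F (Metric.ball 0 1))
    (hF₀ : Tendsto F (𝓝[≠] 0) (𝓝 0)) : (0 : ℂ) ∉ diskPoles F := fun h =>
  absurd h.2 (not_lt.2 ((tendsto_nhds_iff_meromorphicOrderAt_nonneg (hF 0 h.1)).1 ⟨0, hF₀⟩))

/-- Clearing the poles gives a function in the disk algebra. -/
theorem IsMeromorphicExtension.exists_numerator {f : Circle → ℂ} {F : ℂ → ℂ}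
    (h : IsMeromorphicExtension f F) (hF₀ : Tendsto F (𝓝[≠] 0) (𝓝 0))
    (hfin : (diskPoles F).Finite) :
    ∃ P : ℂ → ℂ, IsDiskAlgebra P ∧ (∀ w : Circle, P w = (polePoly F hfin).eval (w : ℂ) * f w) ∧
      P 0 = 0 ∧ ∀ a ∈ diskPoles F, P a ≠ 0 := by
  set Q := polePoly F hfin
  set H : ℂ → ℂ := fun z => Q.eval z * F z with hH
  set U := Metric.ball (0 : ℂ) 1 with hU
  have hm : MeromorphicOn H U := fun z hz =>
    (Q.differentiable.analyticAt z).meromorphicAt.mul (h.meromorphic z hz)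
  -- `H` may have arbitrary values at isolated points. The normal form corrects them, and
  -- nonnegative order then makes it analytic.
  set G := toMeromorphicNFOn H U
  have hGan : ∀ z ∈ U, AnalyticAt ℂ G z := fun z hz => by
    rw [← (meromorphicNFOn_toMeromorphicNFOn H U hz).meromorphicOrderAt_nonneg_iff_analyticAt,
      meromorphicOrderAt_toMeromorphicNFOn hm hz]
    exact meromorphicOrderAt_polePoly_mul_nonneg h.meromorphic hfin hz
  have hGH : ∀ z ∈ U, G =ᶠ[𝓝[≠] z] H := fun z hz => hm.toMeromorphicNFOn_eq_self_on_nhdsNE hz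
  have hGc : ContinuousOn G U := fun z hz => (hGan z hz).continuousAt.continuousWithinAt
  have hbd : ∀ w : Circle, Tendsto G (𝓝[U] (w : ℂ)) (𝓝 (Q.eval (w : ℂ) * f w)) := fun w => by
    have h1 : Tendsto H (𝓝[U] (w : ℂ)) (𝓝 (Q.eval (w : ℂ) * f w)) :=
      (Q.continuous.continuousAt.mono_left nhdsWithin_le_nhds).mul (h.boundary w)
    -- `G` equals `H` only on punctured neighbourhoods. A closed target neighbourhood lets the bound
    -- pass to the excluded points by continuity of `G`.
    rw [(closed_nhds_basis (Q.eval (w : ℂ) * f w)).tendsto_right_iff]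
    rintro V ⟨hV, hVc⟩
    have h2 : ∀ᶠ z in 𝓝[U] (w : ℂ), H z ∈ V := h1 hV
    rw [eventually_nhdsWithin_iff, ← eventually_eventually_nhds] at h2
    rw [eventually_nhdsWithin_iff]
    filter_upwards [h2] with z hz hzU
    have h3 : ∀ᶠ y in 𝓝 z, y ∈ U := Metric.isOpen_ball.mem_nhds hzU
    have h4 : ∀ᶠ y in 𝓝[≠] z, G y ∈ V := by
      filter_upwards [hGH z hzU, nhdsWithin_le_nhds hz, nhdsWithin_le_nhds h3] with y hy1 hy2 hy3
      rw [hy1]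
      exact hy2 hy3
    exact hVc.mem_of_tendsto ((hGan z hzU).continuousAt.mono_left nhdsWithin_le_nhds) h4
  have hcl : closure U = Metric.closedBall 0 1 := closure_ball _ one_ne_zero
  have hsph : ∀ w : Circle, (w : ℂ) ∈ closure U := fun w => by
    rw [hcl, mem_closedBall_zero_iff]; exact (Circle.norm_coe w).le
  have hext : ∀ z ∈ U, extendFrom U G z = G z := extendFrom_extends hGc
  have h0U : (0 : ℂ) ∈ U := by simp [hU]
  refine ⟨extendFrom U G, ⟨?_, ?_⟩, fun w => extendFrom_eq (hsph w) (hbd w), ?_, fun a ha => ?_⟩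
  · exact DifferentiableOn.congr (fun z hz => (hGan z hz).differentiableAt.differentiableWithinAt)
      hext
  · refine continuousOn_extendFrom subset_rfl fun z hz => ?_
    rw [hcl, mem_closedBall_zero_iff] at hz
    rcases hz.lt_or_eq with h1 | h1
    · exact ⟨_, hGc z (by simpa [hU] using h1)⟩
    · exact ⟨_, hbd ⟨z, by simpa [Submonoid.unitSphere] using h1⟩⟩
  · rw [hext 0 h0U]
    have h1 : Tendsto H (𝓝[≠] 0) (𝓝 0) := by
      have := (Q.continuous.continuousAt (x := 0).mono_left nhdsWithin_le_nhds).mul hF₀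
      rwa [mul_zero] at this
    exact tendsto_nhds_unique ((hGan 0 h0U).continuousAt.mono_left nhdsWithin_le_nhds)
      (h1.congr' (hGH 0 h0U).symm)
  · rw [hext a ha.1]
    refine (meromorphicNFOn_toMeromorphicNFOn H U ha.1).meromorphicOrderAt_eq_zero_iff.1 ?_
    rw [meromorphicOrderAt_toMeromorphicNFOn hm ha.1]
    exact meromorphicOrderAt_polePoly_mul h.meromorphic hfin ha

/-! ### Spectral factorization and the Marchenko equations -/

/-- A real function in `H¹` is twice the real part of a function in the disk algebra. -/
theorem IsSobolevCircle.exists_half_analytic {u : AngleCircle → ℝ}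
    (hu : IsSobolevCircle fun x => (u x : ℂ)) :
    ∃ U : ℂ → ℂ, IsDiskAlgebra U ∧ (IsSobolevCircle fun x => U (unitPoint x)) ∧
      (∀ x, 2 * (U (unitPoint x)).re = u x) ∧
      U 0 = fourierCoeff (fun x => (u x : ℂ)) 0 / 2 := by
  set c : ℤ → ℂ := fourierCoeff fun x => (u x : ℂ) with hc
  have hcs : Summable fun n : ℕ => ‖c n‖ := summable_norm_natCast_fourierCoeff hu
  have hcw : Summable fun n : ℕ => (n : ℝ) ^ 2 * ‖c n‖ ^ 2 := by
    simpa [Function.comp_def] using hu.summable.comp_injective (Nat.cast_injective (R := ℤ))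
  have hconj : ∀ n, c (-n) = conj (c n) := fun n => by
    have := fourierCoeff_conj (fun x => (u x : ℂ)) (-n)
    simpa only [Complex.conj_ofReal, neg_neg] using this
  -- Keeping the nonnegative frequencies and halving the zeroth gives `U + Ū = u`, since `c (-n)` is
  -- conjugate to `c n`.
  refine ⟨fun z => powerSum (fun n : ℕ => c n) z - c 0 / 2,
    (isDiskAlgebra_powerSum hcs).sub diffContOnCl_const,
    (isSobolevCircle_powerSum hcs hcw).sub (IsSobolevCircle.const _), fun x => ?_, ?_⟩
  · have h1 := (hu.hasSum_fourier x).nat_add_neg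
    have hs := (summable_norm_powerSum hcs (norm_unitPoint x).le).of_norm.hasSum
    have h2 := hs.add ((Complex.hasSum_conj' (f := fun n : ℕ => c n * unitPoint x ^ n)).2 hs)
    have h3 : powerSum (fun n : ℕ => c n) (unitPoint x)
        + conj (powerSum (fun n : ℕ => c n) (unitPoint x)) = (u x : ℂ) + c 0 := by
      have e : ∀ n : ℕ, c n * unitPoint x ^ n + conj (c n * unitPoint x ^ n)
          = c n * unitPoint x ^ (n : ℤ) + c (-n) * unitPoint x ^ (-(n : ℤ)) := fun n => by
        rw [hconj, map_mul, zpow_natCast, zpow_neg, zpow_natCast, map_pow,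
          ← Complex.inv_eq_conj (norm_unitPoint x), inv_pow]
      simp_rw [e] at h2
      rw [zpow_zero, mul_one] at h1
      exact h2.unique h1
    have h4 : (c 0).im = 0 := by
      have := congrArg Complex.im (hconj 0)
      simp only [neg_zero, Complex.conj_im] at this
      linarith
    have h5 := congrArg Complex.re h3
    simp only [Complex.add_re, Complex.conj_re, Complex.ofReal_re] at h5
    simp only [Complex.sub_re, Complex.div_ofNat_re]
    linarith
  · simp only [powerSum_zero]
    push_cast
    ring

theorem fourierCoeff_zero_eq_integral (u : AngleCircle → ℝ) :
    fourierCoeff (fun x => (u x : ℂ)) 0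
      = ((1 / (2 * Real.pi) * ∫ θ in (0 : ℝ)..(2 * Real.pi), u θ : ℝ) : ℂ) := by
  rw [fourierCoeff_eq_intervalIntegral _ _ 0, zero_add]
  simp only [neg_zero, fourier_zero, one_smul]
  rw [intervalIntegral.integral_ofReal, Complex.real_smul]
  push_cast
  ring

/-- The outer function `V` which normalizes the pair `(Q, P)` on the circle. -/
theorem exists_outer_normalization {Q : Polynomial ℂ} {P : ℂ → ℂ}
    (hPs : IsSobolevCircle fun x => P (unitPoint x)) (hQ : ∀ x, Q.eval (unitPoint x) ≠ 0) :
    ∃ V : ℂ → ℂ, IsDiskAlgebra V ∧ (IsSobolevCircle fun x => V (unitPoint x)) ∧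
      (∀ z, V z ≠ 0) ∧
      (∀ x, ‖V (unitPoint x)‖ ^ 2 *
        (‖Q.eval (unitPoint x)‖ ^ 2 + ‖P (unitPoint x)‖ ^ 2) = 1) ∧
      2 * Real.log ‖V 0‖ = -(1 / (2 * Real.pi) * ∫ θ in (0 : ℝ)..(2 * Real.pi),
        Real.log (‖Q.eval (unitPoint θ)‖ ^ 2 + ‖P (unitPoint θ)‖ ^ 2)) := by
  set v : AngleCircle → ℝ :=
    fun x => ‖Q.eval (unitPoint x)‖ ^ 2 + ‖P (unitPoint x)‖ ^ 2 with hv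
  have hQs := IsSobolevCircle.polynomial Q
  have hvs : IsSobolevCircle fun x => (v x : ℂ) := by
    have h := (hQs.star.mul hQs).add (hPs.star.mul hPs)
    simp only [Complex.conj_mul'] at h
    simpa [hv] using h
  have hv0 : ∀ x, 0 < v x := fun x => by
    have := norm_pos_iff.2 (hQ x)
    positivity
  obtain ⟨U, hU, hUs, hUre, hU0⟩ := (IsSobolevCircle.log hvs hv0).exists_half_analytic
  have hneg : IsDiskAlgebra fun z => -U z := hU.neg
  -- As `2 Re U = log v` on the circle, `exp (-U)` has squared modulus `1 / v` there and no zeros;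
  -- its value at the origin is governed by the mean of `log v`.
  refine ⟨fun z => Complex.exp (-U z), ?_, ?_, fun z => Complex.exp_ne_zero _, fun x => ?_, ?_⟩
  · exact Complex.differentiable_exp.comp_diffContOnCl hneg
  · have h := ((IsSobolevCircle.const 0).sub hUs).cexp
    simpa using h
  · rw [Complex.norm_exp, Complex.neg_re, ← Real.exp_nat_mul]
    have h1 : ((2 : ℕ) : ℝ) * -(U (unitPoint x)).re = -Real.log (v x) := by
      push_cast; linarith [hUre x]
    rw [h1, Real.exp_neg, Real.exp_log (hv0 x)]
    exact inv_mul_cancel₀ (hv0 x).ne'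
  · rw [Complex.norm_exp, Real.log_exp, Complex.neg_re, hU0, fourierCoeff_zero_eq_integral,
      ← Complex.ofReal_ofNat, ← Complex.ofReal_div, Complex.ofReal_re]
    ring

theorem neg_natCast_add_one_injective : Function.Injective fun n : ℕ => -((n : ℤ) + 1) :=
  fun m n h => by simpa using h

/-- The Marchenko equations for a normalized pair `(A, B)` in the disk algebra with `B 0 = 0`. -/
theorem isMarchenkoSolution_fourierCoeff {A B D l : ℂ → ℂ} {E : Polynomial ℂ}
    (hA : IsDiskAlgebra A) (hB : IsDiskAlgebra B) (hD : IsDiskAlgebra D)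
    (hAs : IsSobolevCircle fun x => A (unitPoint x))
    (hBs : IsSobolevCircle fun x => B (unitPoint x))
    (hls : IsSobolevCircle fun x => l (unitPoint x))
    (hA0 : A 0 ≠ 0) (hB0 : B 0 = 0)
    (h1 : ∀ x, conj (B (unitPoint x)) = A (unitPoint x) * l (unitPoint x) + E.eval (unitPoint x))
    (h2 : ∀ x, conj (A (unitPoint x)) = D (unitPoint x) - B (unitPoint x) * l (unitPoint x)) :
    IsMarchenkoSolution
      (fun m => fourierCoeff (fun x : AngleCircle => l (unitPoint x)) (-((m : ℤ) + 1)))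
      (fun n => fourierCoeff (fun x : AngleCircle => A (unitPoint x)) n)
      (fun n => fourierCoeff (fun x : AngleCircle => B (unitPoint x)) ((n + 1 : ℕ) : ℤ)) := by
  have hac := summable_norm_natCast_fourierCoeff hAs
  have hbc := summable_norm_natCast_fourierCoeff hBs
  refine ⟨hls.summable_fourierCoeff.comp_injective neg_natCast_add_one_injective, hac,
    (summable_nat_add_iff 1).2 hbc, ?_, fun m => ?_, fun m => ?_⟩
  · simpa [hA.fourierCoeff_zero] using hA0
  · have e1 := fourierCoeff_conj (fun x => B (unitPoint x)) (-((m : ℤ) + 1))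
    rw [neg_neg] at e1
    push_cast
    rw [← e1]
    simp_rw [h1]
    rw [fourierCoeff_add_of_continuous (hAs.mul hls).continuous
      (isDiskAlgebra_polynomial E).continuous_boundary,
      (isDiskAlgebra_polynomial E).fourierCoeff_neg_succ m, add_zero]
    have e2 := fourierCoeff_powerSum_mul hac hls.continuous (-((m : ℤ) + 1))
    simp_rw [← hA.eq_powerSum hAs] at e2
    rw [e2]
    refine tsum_congr fun k => ?_
    rw [mul_comm]
    congr 2
    ring
  · have e1 := fourierCoeff_conj (fun x => A (unitPoint x)) (-((m : ℤ) + 1))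
    rw [neg_neg] at e1
    push_cast
    rw [← e1]
    simp_rw [h2]
    rw [fourierCoeff_sub_of_continuous hD.continuous_boundary
      (hBs.mul hls).continuous, hD.fourierCoeff_neg_succ m, zero_sub]
    have e2 := fourierCoeff_powerSum_mul hbc hls.continuous (-((m : ℤ) + 1))
    simp_rw [← hB.eq_powerSum hBs] at e2
    have hsum : Summable fun k : ℕ => fourierCoeff (fun x : AngleCircle => B (unitPoint x)) k *
        fourierCoeff (fun x : AngleCircle => l (unitPoint x)) (-((m : ℤ) + 1) - k) := by
      have h3 := hls.summable_fourierCoeff.comp_injective (neg_natCast_add_one_injective)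
      refine (summable_hankel h3 hbc m).of_norm.congr fun k => ?_
      rw [mul_comm]
      dsimp only
      congr 2
      push_cast
      ring
    -- The term `k = 0` vanishes because `B 0 = 0`; the resulting shift matches the coefficients `b`
    -- of `B / z`.
    rw [e2, hsum.tsum_eq_zero_add]
    simp only [Nat.cast_zero, hB.fourierCoeff_zero, hB0, zero_mul, zero_add]
    congr 1
    refine tsum_congr fun k => ?_
    rw [mul_comm]
    push_cast
    congr 2
    ring

/-- A factorization `r₀ = P / Q` of a reflection coefficient, with the outer function `V` which
normalizes `(Q, P)` on the circle and cofactors for the coprime pair `P V`, `Q`. -/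
structure IsScatteringPair (r₀ : Circle → ℂ) (Q : Polynomial ℂ) (P V D : ℂ → ℂ)
    (E : Polynomial ℂ) : Prop where
  numerator : IsDiskAlgebra P
  outer : IsDiskAlgebra V
  cofactor : IsDiskAlgebra D
  numerator_sobolev : IsSobolevCircle fun x => P (unitPoint x)
  outer_sobolev : IsSobolevCircle fun x => V (unitPoint x)
  denominator_ne : ∀ x, Q.eval (unitPoint x) ≠ 0
  denominator_zero : Q.eval 0 ≠ 0
  numerator_zero : P 0 = 0
  outer_ne : ∀ z, V z ≠ 0
  boundary : ∀ w : Circle, P w = Q.eval (w : ℂ) * r₀ w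
  normalized : ∀ x, ‖V (unitPoint x)‖ ^ 2 *
    (‖Q.eval (unitPoint x)‖ ^ 2 + ‖P (unitPoint x)‖ ^ 2) = 1
  bezout : ∀ z, E.eval z * (P z * V z) + D z * Q.eval z = 1

theorem IsMeromorphicExtension.exists_isScatteringPair {r₀ : Circle → ℂ} {F : ℂ → ℂ}
    (h : IsMeromorphicExtension r₀ F) (hF₀ : Tendsto F (𝓝[≠] 0) (𝓝 0))
    (hfin : (diskPoles F).Finite)
    (hs : IsSobolevCircle fun x => r₀ (AddCircle.toCircle x)) :
    ∃ (P V D : ℂ → ℂ) (E : Polynomial ℂ), IsScatteringPair r₀ (polePoly F hfin) P V D E ∧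
      2 * Real.log ‖V 0‖ = -(1 / (2 * Real.pi) * ∫ θ in (0 : ℝ)..(2 * Real.pi),
        Real.log (‖(polePoly F hfin).eval (unitPoint θ)‖ ^ 2 + ‖P (unitPoint θ)‖ ^ 2)) := by
  obtain ⟨P, hP, hPb, hP0, hPa⟩ := h.exists_numerator hF₀ hfin
  have hPs : IsSobolevCircle fun x => P (unitPoint x) := by
    simp only [unitPoint, hPb]
    exact (IsSobolevCircle.polynomial _).mul hs
  have hQ : ∀ x, (polePoly F hfin).eval (unitPoint x) ≠ 0 := fun x =>
    eval_polePoly_ne_zero hfin fun hx => by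
      have := hx.1
      rw [mem_ball_zero_iff, norm_unitPoint] at this
      exact lt_irrefl _ this
  obtain ⟨V, hV, hVs, hV0, hn, hlog⟩ := exists_outer_normalization hPs hQ
  obtain ⟨E, D, hD, hE⟩ := hasBezout_prod (hP.mul hV) hfin.toFinset (poleMultiplicity F)
    fun a ha => ⟨(hfin.mem_toFinset.1 ha).1,
      mul_ne_zero (hPa a (hfin.mem_toFinset.1 ha)) (hV0 a)⟩
  exact ⟨P, V, D, E, ⟨hP, hV, hD, hPs, hVs, hQ,
    eval_polePoly_ne_zero hfin (zero_notMem_diskPoles h.meromorphic hF₀), hP0, hV0, hPb, hn, hE⟩,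
    hlog⟩

theorem toCircle_surjective : Function.Surjective (AddCircle.toCircle (T := 2 * Real.pi)) :=
  fun w => ⟨((Complex.arg w : ℝ) : AngleCircle), by
    rw [AddCircle.toCircle_apply_mk, div_self Real.two_pi_pos.ne', one_mul, Circle.exp_arg]⟩

/-- Multiply by `A = q v`: normalization gives `A Ā = 1 - B B̄` with `B = p v`, and Bézout gives `1
- e B = d q`. -/
theorem conj_eq_cofactor_sub {q p v e d : ℂ} (hq : q ≠ 0) (hv : v ≠ 0)
    (hb : e * (p * v) + d * q = 1) (hn : ‖v‖ ^ 2 * (‖q‖ ^ 2 + ‖p‖ ^ 2) = 1) :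
    conj (q * v) = d * v⁻¹ - p * v * ((conj (p * v) - e) * (q * v)⁻¹) := by
  have h4 : conj (q * v) * (q * v) + conj (p * v) * (p * v) = 1 := by
    rw [Complex.conj_mul', Complex.conj_mul', norm_mul, norm_mul]
    norm_cast
    linarith
  generalize conj (q * v) = s at *
  generalize conj (p * v) = t at *
  field_simp
  linear_combination h4 - hb

theorem summable_weighted_neg {c : ℤ → ℂ} (h : Summable fun n : ℤ => (n : ℝ) ^ 2 * ‖c n‖ ^ 2) :
    Summable fun n : ℕ => ((n : ℝ) + 1) ^ 2 * ‖c (-((n : ℤ) + 1))‖ ^ 2 := by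
  refine (h.comp_injective neg_natCast_add_one_injective).congr fun n => ?_
  have : (((-((n : ℤ) + 1)) : ℤ) : ℝ) ^ 2 = ((n : ℝ) + 1) ^ 2 := by push_cast; ring
  rw [Function.comp, this]

theorem IsDiskAlgebra.eq_mul_powerSum {f : ℂ → ℂ} (hf : IsDiskAlgebra f) (h0 : f 0 = 0)
    (hs : IsSobolevCircle fun x => f (unitPoint x)) (x : AngleCircle) :
    f (unitPoint x) = unitPoint x * powerSum (fun n : ℕ => fourierCoeff
      (fun x : AngleCircle => f (unitPoint x)) ((n + 1 : ℕ) : ℤ)) (unitPoint x) := by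
  have e := powerSum_eq_add (summable_norm_natCast_fourierCoeff hs) (norm_unitPoint x).le
  rwa [← hf.eq_powerSum hs x, Nat.cast_zero, hf.fourierCoeff_zero, h0, zero_add] at e

theorem exists_isMarchenkoSolution_of_diskAlgebra {A B D l : ℂ → ℂ} {E : Polynomial ℂ}
    (hA : IsDiskAlgebra A) (hB : IsDiskAlgebra B) (hD : IsDiskAlgebra D)
    (hAs : IsSobolevCircle fun x => A (unitPoint x))
    (hBs : IsSobolevCircle fun x => B (unitPoint x))
    (hls : IsSobolevCircle fun x => l (unitPoint x))
    (hA0 : A 0 ≠ 0) (hB0 : B 0 = 0)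
    (h1 : ∀ x, conj (B (unitPoint x)) = A (unitPoint x) * l (unitPoint x) + E.eval (unitPoint x))
    (h2 : ∀ x, conj (A (unitPoint x)) = D (unitPoint x) - B (unitPoint x) * l (unitPoint x)) :
    ∃ lam a b : ℕ → ℂ, IsMarchenkoSolution lam a b ∧
      (Summable fun k => (∑' n, ‖lam (n + k)‖) ^ 3) ∧
      ∀ x, powerSum a (unitPoint x) = A (unitPoint x) ∧
        unitPoint x * powerSum b (unitPoint x) = B (unitPoint x) := by
  have hsol := isMarchenkoSolution_fourierCoeff hA hB hD hAs hBs hls hA0 hB0 h1 h2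
  have hw := summable_weighted_neg hls.summable
  have hAe := hA.eq_powerSum hAs
  have hBe := hB.eq_mul_powerSum hB0 hBs
  generalize (fun n : ℕ => fourierCoeff (fun x : AngleCircle => A (unitPoint x)) n) = a at *
  generalize (fun n : ℕ => fourierCoeff (fun x : AngleCircle => B (unitPoint x))
    ((n + 1 : ℕ) : ℤ)) = b at *
  generalize hl : (fun m : ℕ => fourierCoeff (fun x : AngleCircle => l (unitPoint x))
    (-((m : ℤ) + 1))) = lam at *
  have hw' : Summable fun n : ℕ => ((n : ℝ) + 1) ^ 2 * ‖lam n‖ ^ 2 := by rw [← hl]; exact hw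
  exact ⟨lam, a, b, hsol, summable_cube_tsum_tail hw', fun x => ⟨(hAe x).symm, (hBe x).symm⟩⟩

/-- The inverse scattering problem for a scattering pair: the pair has Taylor coefficients which
solve a Marchenko system with a kernel in the weighted space. -/
theorem IsScatteringPair.exists_isMarchenkoSolution {r₀ : Circle → ℂ} {Q E : Polynomial ℂ}
    {P V D : ℂ → ℂ} (h : IsScatteringPair r₀ Q P V D E) :
    ∃ lam a b : ℕ → ℂ, IsMarchenkoSolution lam a b ∧
      (Summable fun k => (∑' n, ‖lam (n + k)‖) ^ 3) ∧
      ∀ w : Circle, powerSum a w ≠ 0 ∧ (w : ℂ) * powerSum b w = powerSum a w * r₀ w := by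
  have hAs := (IsSobolevCircle.polynomial Q).mul h.outer_sobolev
  have hBs := h.numerator_sobolev.mul h.outer_sobolev
  have hA1 : ∀ x, Q.eval (unitPoint x) * V (unitPoint x) ≠ 0 := fun x =>
    mul_ne_zero (h.denominator_ne x) (h.outer_ne _)
  obtain ⟨lam, a, b, hsol, hc, hab⟩ := exists_isMarchenkoSolution_of_diskAlgebra
    (A := fun z => Q.eval z * V z) (B := fun z => P z * V z) (D := fun z => D z * (V z)⁻¹)
    -- With `E = 0` the sum `Ā + B l` would be `1 / A`, which has poles at the zeros of `Q`. The
    -- cofactor removes them and leaves the disk algebra function `D / V`.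
    (l := fun z => (conj (P z * V z) - E.eval z) * (Q.eval z * V z)⁻¹) (E := E)
    ((isDiskAlgebra_polynomial Q).mul h.outer) (h.numerator.mul h.outer)
    (h.cofactor.mul (h.outer.inv fun z _ => h.outer_ne z)) hAs hBs
    ((hBs.star.sub (IsSobolevCircle.polynomial E)).mul (hAs.inv hA1))
    (mul_ne_zero h.denominator_zero (h.outer_ne 0)) (by simp [h.numerator_zero])
    (fun x => by
      rw [mul_left_comm, mul_inv_cancel₀ (hA1 x), mul_one, sub_add_cancel])
    (fun x => conj_eq_cofactor_sub (h.denominator_ne x) (h.outer_ne _) (h.bezout _)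
      (h.normalized x))
  refine ⟨lam, a, b, hsol, hc, fun w => ?_⟩
  obtain ⟨x, rfl⟩ := toCircle_surjective w
  obtain ⟨e1, e2⟩ := hab x
  refine ⟨fun h0 => hA1 x (e1.symm.trans h0), e2.trans ?_⟩
  rw [e1, show P (unitPoint x) = _ from h.boundary (AddCircle.toCircle x)]
  ring

/-! ### Construction of the pulse -/

/-- The pulse with a prescribed parameter. -/
noncomputable def pulseOfParam (γ : ℂ) : ℂ :=
  Complex.I * (γ / ‖γ‖) * ((2 * Real.arctan ‖γ‖ : ℝ) : ℂ)

theorem norm_pulseOfParam (γ : ℂ) : ‖pulseOfParam γ‖ = 2 * Real.arctan ‖γ‖ := by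
  by_cases h : γ = 0
  · simp [pulseOfParam, h]
  · have h1 : ‖γ‖ ≠ 0 := norm_ne_zero_iff.2 h
    have h2 : 0 ≤ Real.arctan ‖γ‖ := Real.arctan_nonneg.2 (norm_nonneg _)
    rw [pulseOfParam, norm_mul, norm_mul, Complex.norm_I, norm_div, Complex.norm_real,
      Complex.norm_real, norm_norm, div_self h1, one_mul, one_mul,
      Real.norm_of_nonneg (by positivity)]

theorem norm_pulseOfParam_lt_pi (γ : ℂ) : ‖pulseOfParam γ‖ < Real.pi := by
  rw [norm_pulseOfParam]
  linarith [Real.arctan_lt_pi_div_two ‖γ‖]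

theorem norm_pulseOfParam_le (γ : ℂ) : ‖pulseOfParam γ‖ ≤ 2 * ‖γ‖ := by
  rw [norm_pulseOfParam]
  rcases (norm_nonneg γ).eq_or_lt with h | h
  · simp [← h]
  · have h1 := Real.lt_tan (Real.arctan_pos.2 h) (Real.arctan_lt_pi_div_two _)
    rw [Real.tan_arctan] at h1
    linarith

theorem pulseParam_pulseOfParam (γ : ℂ) : pulseParam (pulseOfParam γ) = γ := by
  by_cases h : γ = 0
  · simp [pulseOfParam, pulseParam, h]
  · have h1 : ‖γ‖ ≠ 0 := norm_ne_zero_iff.2 h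
    have h1' : (‖γ‖ : ℂ) ≠ 0 := by exact_mod_cast h1
    have h2 : 0 < Real.arctan ‖γ‖ := Real.arctan_pos.2 (norm_pos_iff.2 h)
    have h3 : ((2 * Real.arctan ‖γ‖ : ℝ) : ℂ) ≠ 0 := by
      exact_mod_cast (by positivity : 2 * Real.arctan ‖γ‖ ≠ 0)
    rw [pulseParam, norm_pulseOfParam, pulseOfParam, mul_div_assoc, div_self h3,
      mul_div_cancel_left₀ _ two_ne_zero, Real.tan_arctan]
    field_simp
    rw [Complex.I_sq]
    ring

theorem pulseRotation_zero (v : Fin 3 → ℝ) : pulseRotation 0 v = v := by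
  simp [pulseRotation]

theorem sub_one_sub_natCast_injective (ρ : ℤ) : Function.Injective fun k : ℕ => ρ - 1 - (k : ℤ) :=
  fun m n h => by simpa using h

theorem hasSum_int_iff_of_eq_zero {f : ℤ → ℝ} {ρ : ℤ} (hf : ∀ j, ρ ≤ j → f j = 0) {s : ℝ} :
    HasSum f s ↔ HasSum (fun k : ℕ => f (ρ - 1 - k)) s := by
  refine ((sub_one_sub_natCast_injective ρ).hasSum_iff fun j hj => hf j ?_).symm
  by_contra hlt
  exact hj ⟨(ρ - 1 - j).toNat, by dsimp only; omega⟩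

namespace IsMarchenkoSolution

variable {lam a b : ℕ → ℂ}

/-- Together with `step_snd`: applying the stripped pulse and one precession restores the old pair
up to a nonzero scalar, which `hopf` ignores. -/
theorem step_fst (h : IsMarchenkoSolution lam a b) {z : ℂ} (hz : ‖z‖ ≤ 1) :
    powerSum (stripA a b) z - conj (b 0 / a 0) * (z * powerSum (stripB a b) z)
      = (1 + (‖b 0 / a 0‖ : ℂ) ^ 2) * powerSum a z := by
  rw [h.powerSum_stripA hz, h.mul_powerSum_stripB hz, ← Complex.conj_mul']
  ring

theorem step_snd (h : IsMarchenkoSolution lam a b) {z : ℂ} (hz : ‖z‖ ≤ 1) :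
    z * (z * powerSum (stripB a b) z + b 0 / a 0 * powerSum (stripA a b) z)
      = (1 + (‖b 0 / a 0‖ : ℂ) ^ 2) * (z * powerSum b z) := by
  rw [h.powerSum_stripA hz, h.mul_powerSum_stripB hz, ← Complex.conj_mul']
  ring

theorem one_add_norm_sq_ne_zero (γ : ℂ) : (1 + (‖γ‖ : ℂ) ^ 2) ≠ 0 := by
  have : (0 : ℝ) < 1 + ‖γ‖ ^ 2 := by positivity
  exact_mod_cast this.ne'

theorem stripped_ne_zero (h : IsMarchenkoSolution lam a b) {z : ℂ} (hz : ‖z‖ ≤ 1)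
    (h0 : powerSum a z ≠ 0) (k : ℕ) :
    powerSum (_root_.stripped a b k).1 z ≠ 0 ∨ z * powerSum (_root_.stripped a b k).2 z ≠ 0 := by
  induction k with
  | zero => exact Or.inl h0
  | succ k ih =>
    by_contra! hc
    have h1 := (h.stripped k).step_fst hz
    have h2 := (h.stripped k).step_snd hz
    simp only [_root_.stripped] at hc
    rw [hc.1, hc.2, mul_zero, sub_zero] at h1
    rw [hc.1, hc.2, mul_zero, add_zero, mul_zero] at h2
    rcases ih with ih | ih
    · exact mul_ne_zero (one_add_norm_sq_ne_zero _) ih h1.symm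
    · exact mul_ne_zero (one_add_norm_sq_ne_zero _) ih h2.symm

/-- The magnetization before the last `k` pulses. -/
theorem hopf_stripped (h : IsMarchenkoSolution lam a b) (w : Circle)
    (h0 : powerSum a (w : ℂ) ≠ 0) (k : ℕ) :
    hopf (powerSum (_root_.stripped a b k).1 w) (w * powerSum (_root_.stripped a b k).2 w)
      = precession w (pulseRotation (pulseOfParam (strippedParam a b k))
          (hopf (powerSum (_root_.stripped a b (k + 1)).1 w)
            (w * powerSum (_root_.stripped a b (k + 1)).2 w))) := by
  have hw : ‖(w : ℂ)‖ ≤ 1 := (Circle.norm_coe w).le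
  rw [pulseRotation_hopf (norm_pulseOfParam_lt_pi _) (h.stripped_ne_zero hw h0 (k + 1)),
    pulseParam_pulseOfParam, precession_hopf]
  have h1 := (h.stripped k).step_fst hw
  have h2 := (h.stripped k).step_snd hw
  simp only [strippedParam, _root_.stripped]
  rw [h1, h2, hopf_smul (one_add_norm_sq_ne_zero _)]

theorem tendsto_hopf_stripped (h : IsMarchenkoSolution lam a b) (w : Circle) :
    Tendsto (fun k => hopf (powerSum (_root_.stripped a b k).1 w)
      (w * powerSum (_root_.stripped a b k).2 w)) atTop (𝓝 ![0, 0, 1]) := by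
  have hw : ‖(w : ℂ)‖ ≤ 1 := (Circle.norm_coe w).le
  have h1 := (tendsto_const_nhds (x := (1 : ℂ))).hopf (h.tendsto_powerSum_div hw)
    (Or.inl one_ne_zero)
  rw [hopf_one_zero] at h1
  refine h1.congr' ?_
  filter_upwards [h.eventually_powerSum_ne_zero hw] with k hk
  rw [hopf_eq_hopf_one hk]

theorem exists_isRephasedPulse (h : IsMarchenkoSolution lam a b)
    (hc : Summable fun k => (∑' n, ‖lam (n + k)‖) ^ 3) {r₀ : Circle → ℂ}
    (hr₀ : ∀ w : Circle, powerSum a w ≠ 0 ∧ (w : ℂ) * powerSum b w = powerSum a w * r₀ w)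
    {ρ : ℤ} {M : Circle → Fin 3 → ℝ} (hM : ∀ w, M w = hopf 1 ((w : ℂ) ^ (-ρ) * r₀ w)) :
    ∃ ω : ℤ → ℂ, IsRephasedPulse ρ M ω := by
  -- Layers are stripped backwards in time: layer `k` is the pulse at `j = ρ - 1 - k`, layer `0`
  -- being the last one.
  set ω : ℤ → ℂ := fun j =>
    if j < ρ then pulseOfParam (strippedParam a b (ρ - 1 - j).toNat) else 0 with hω
  have hωk : ∀ k : ℕ, ω (ρ - 1 - k) = pulseOfParam (strippedParam a b k) := fun k => by
    have h1 : ρ - 1 - (k : ℤ) < ρ := by omega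
    simp only [hω, if_pos h1]
    congr 2
    omega
  have hω0 : ∀ j, ρ ≤ j → ω j = 0 := fun j hj => by simp [hω, not_lt.2 hj]
  refine ⟨ω, ⟨?_, fun j => ?_, hω0, fun w => ?_⟩⟩
  · have h1 : Summable fun k : ℕ => ‖ω (ρ - 1 - k)‖ := by
      simp_rw [hωk]
      exact Summable.of_nonneg_of_le (fun _ => norm_nonneg _) (fun k => norm_pulseOfParam_le _)
        ((h.summable_strippedParam hc).mul_left 2)
    exact ((hasSum_int_iff_of_eq_zero (f := fun j => ‖ω j‖)
      fun j hj => by simp [hω0 j hj]).2 h1.hasSum).summable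
  · by_cases hj : j < ρ
    · simp only [hω, if_pos hj]
      exact norm_pulseOfParam_lt_pi _
    · rw [hω0 j (not_lt.1 hj), norm_zero]
      exact Real.pi_pos
  · set S : ℕ → Fin 3 → ℝ := fun k => hopf (powerSum (_root_.stripped a b k).1 w)
      (w * powerSum (_root_.stripped a b k).2 w) with hS
    -- Before time `ρ` the state is the one with `ρ - j` layers stripped; from `ρ` on, the final
    -- state precesses freely.
    set m : ℤ → Fin 3 → ℝ := fun j =>
      if j < ρ then S (ρ - j).toNat else precession (w ^ (j - ρ)) (S 0) with hm
    refine ⟨m, fun j => ?_, ?_, ?_⟩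
    · rcases lt_or_ge j ρ with hj | hj
      · obtain ⟨k, hk⟩ : ∃ k : ℕ, j = ρ - 1 - k := ⟨(ρ - 1 - j).toNat, by omega⟩
        have e1 : m (j + 1) = S k := by
          rcases lt_or_ge (j + 1) ρ with hj1 | hj1
          · simp only [hm, if_pos hj1]
            congr 1
            omega
          · have hk0 : k = 0 := by omega
            have hj2 : j + 1 - ρ = 0 := by omega
            simp only [hm, if_neg (not_lt.2 hj1), hj2, zpow_zero, precession_one, hk0]
        have e2 : m j = S (k + 1) := by
          simp only [hm, if_pos hj]
          congr 1
          omega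
        rw [e1, e2, hk, hωk]
        exact h.hopf_stripped w (hr₀ w).1 k
      · have hj1 : ¬ j + 1 < ρ := by omega
        simp only [hm, if_neg hj1, if_neg (not_lt.2 hj), hω0 j hj, pulseRotation_zero,
          precession_precession]
        congr 1
        rw [show j + 1 - ρ = 1 + (j - ρ) by ring, zpow_add, zpow_one]
    · have h1 : Tendsto (fun j : ℤ => (ρ - j).toNat) atBot atTop := by
        refine tendsto_atTop.2 fun n => ?_
        filter_upwards [eventually_le_atBot (ρ - n)] with j hj
        omega
      refine ((h.tendsto_hopf_stripped w).comp h1).congr' ?_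
      filter_upwards [eventually_lt_atBot ρ] with j hj
      simp only [hm, if_pos hj, Function.comp, hS]
    · refine tendsto_const_nhds.congr' ?_
      filter_upwards [eventually_ge_atTop ρ] with j hj
      simp only [hm, if_neg (not_lt.2 hj), precession_precession, ← zpow_add]
      rw [show -j + (j - ρ) = -ρ by ring]
      simp only [hS, _root_.stripped]
      rw [precession_hopf, hopf_eq_hopf_one (hr₀ w).1, hM w, (hr₀ w).2]
      congr 1
      have := (hr₀ w).1
      rw [Circle.coe_zpow]
      field_simp

end IsMarchenkoSolution

/-! ### Direct scattering for summable pulses -/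

/-- The homogeneous coordinates produced by the pulses with parameters `γ (n - 1), …, γ 0`, starting
from equilibrium. -/
noncomputable def spinor (z : ℂ) : ℕ → (ℕ → ℂ) → ℂ × ℂ
  | 0, _ => (1, 0)
  | n + 1, γ =>
    ((spinor z n fun k => γ (k + 1)).1 - conj (γ 0) * (spinor z n fun k => γ (k + 1)).2,
      z * ((spinor z n fun k => γ (k + 1)).2 + γ 0 * (spinor z n fun k => γ (k + 1)).1))

theorem spinor_succ (z : ℂ) (n : ℕ) (γ : ℕ → ℂ) : spinor z (n + 1) γ =
    ((spinor z n fun k => γ (k + 1)).1 - conj (γ 0) * (spinor z n fun k => γ (k + 1)).2,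
      z * ((spinor z n fun k => γ (k + 1)).2 + γ 0 * (spinor z n fun k => γ (k + 1)).1)) := rfl

theorem spinor_zero_right (n : ℕ) (γ : ℕ → ℂ) : spinor 0 n γ = (1, 0) := by
  induction n generalizing γ with
  | zero => rfl
  | succ n ih => simp [spinor, ih]

theorem differentiable_spinor (n : ℕ) (γ : ℕ → ℂ) :
    (Differentiable ℂ fun z => (spinor z n γ).1) ∧
      Differentiable ℂ fun z => (spinor z n γ).2 := by
  induction n generalizing γ with
  | zero => exact ⟨differentiable_const _, differentiable_const _⟩
  | succ n ih =>
    obtain ⟨h1, h2⟩ := ih fun k => γ (k + 1)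
    exact ⟨h1.sub (h2.const_mul _), differentiable_id.mul (h2.add (h1.const_mul _))⟩

theorem normSq_spinor {z : ℂ} (hz : ‖z‖ = 1) (n : ℕ) (γ : ℕ → ℂ) :
    Complex.normSq (spinor z n γ).1 + Complex.normSq (spinor z n γ).2
      = ∏ i ∈ Finset.range n, (1 + ‖γ i‖ ^ 2) := by
  have hz' : Complex.normSq z = 1 := by rw [Complex.normSq_eq_norm_sq, hz, one_pow]
  induction n generalizing γ with
  | zero => simp [spinor]
  | succ n ih =>
    rw [spinor, Finset.prod_range_succ', ← ih fun k => γ (k + 1), map_mul, hz', one_mul,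
      normSq_add_normSq_step, Complex.normSq_eq_norm_sq (γ 0), mul_comm]

/-- Lengthening the sequence inserts a pulse at the initial end, and the later steps are linear with
`ℓ¹` norm at most `1 + ‖γ i‖`. -/
theorem norm_spinor_sub_le {z : ℂ} (hz : ‖z‖ ≤ 1) (n : ℕ) (γ : ℕ → ℂ) :
    ‖(spinor z (n + 1) γ).1 - (spinor z n γ).1‖ + ‖(spinor z (n + 1) γ).2 - (spinor z n γ).2‖
      ≤ (∏ i ∈ Finset.range n, (1 + ‖γ i‖)) * ‖γ n‖ := by
  induction n generalizing γ with
  | zero =>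
    simp only [spinor, Finset.range_zero, Finset.prod_empty, one_mul]
    simpa using mul_le_of_le_one_left (norm_nonneg (γ 0)) hz
  | succ n ih =>
    have h := ih fun k => γ (k + 1)
    rw [Finset.prod_range_succ']
    rw [spinor_succ z (n + 1) γ, spinor_succ z n γ]
    dsimp only
    generalize spinor z (n + 1) (fun k => γ (k + 1)) = X at *
    generalize spinor z n (fun k => γ (k + 1)) = Y at *
    have e1 : X.1 - conj (γ 0) * X.2 - (Y.1 - conj (γ 0) * Y.2)
        = (X.1 - Y.1) - conj (γ 0) * (X.2 - Y.2) := by ring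
    have e2 : z * (X.2 + γ 0 * X.1) - z * (Y.2 + γ 0 * Y.1)
        = z * ((X.2 - Y.2) + γ 0 * (X.1 - Y.1)) := by ring
    rw [e1, e2]
    have h1 : ‖(X.1 - Y.1) - conj (γ 0) * (X.2 - Y.2)‖ ≤ ‖X.1 - Y.1‖ + ‖γ 0‖ * ‖X.2 - Y.2‖ := by
      refine (norm_sub_le _ _).trans ?_
      rw [norm_mul, RCLike.norm_conj]
    have h2 : ‖z * ((X.2 - Y.2) + γ 0 * (X.1 - Y.1))‖ ≤ ‖X.2 - Y.2‖ + ‖γ 0‖ * ‖X.1 - Y.1‖ := by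
      rw [norm_mul]
      refine (mul_le_of_le_one_left (norm_nonneg _) hz).trans ((norm_add_le _ _).trans ?_)
      rw [norm_mul]
    calc _ ≤ (1 + ‖γ 0‖) * (‖X.1 - Y.1‖ + ‖X.2 - Y.2‖) := by linarith
      _ ≤ (1 + ‖γ 0‖) * ((∏ i ∈ Finset.range n, (1 + ‖γ (i + 1)‖)) * ‖γ (n + 1)‖) := by gcongr
      _ = _ := by ring

theorem prod_one_add_norm_le {γ : ℕ → ℂ} (hγ : Summable fun n => ‖γ n‖) (n : ℕ) :
    ∏ i ∈ Finset.range n, (1 + ‖γ i‖) ≤ Real.exp (∑' n, ‖γ n‖) := by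
  calc ∏ i ∈ Finset.range n, (1 + ‖γ i‖) ≤ ∏ i ∈ Finset.range n, Real.exp ‖γ i‖ :=
        Finset.prod_le_prod (fun _ _ => by positivity) fun i _ => by
          rw [add_comm]; exact Real.add_one_le_exp _
    _ = Real.exp (∑ i ∈ Finset.range n, ‖γ i‖) := (Real.exp_sum _ _).symm
    _ ≤ _ := Real.exp_le_exp.2 (hγ.sum_le_tsum _ fun _ _ => norm_nonneg _)

theorem norm_spinor_sub_le_exp {γ : ℕ → ℂ} (hγ : Summable fun n => ‖γ n‖) {z : ℂ} (hz : ‖z‖ ≤ 1)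
    (n : ℕ) :
    ‖(spinor z (n + 1) γ).1 - (spinor z n γ).1‖ ≤ Real.exp (∑' n, ‖γ n‖) * ‖γ n‖ ∧
      ‖(spinor z (n + 1) γ).2 - (spinor z n γ).2‖ ≤ Real.exp (∑' n, ‖γ n‖) * ‖γ n‖ := by
  have h := (norm_spinor_sub_le hz n γ).trans
    (mul_le_mul_of_nonneg_right (prod_one_add_norm_le hγ n) (norm_nonneg _))
  have h1 := norm_nonneg ((spinor z (n + 1) γ).1 - (spinor z n γ).1)
  have h2 := norm_nonneg ((spinor z (n + 1) γ).2 - (spinor z n γ).2)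
  exact ⟨by linarith, by linarith⟩

/-- The limit of the first coordinates of the spinors. -/
noncomputable def scatterA (γ : ℕ → ℂ) (z : ℂ) : ℂ :=
  ∑' n, ((spinor z (n + 1) γ).1 - (spinor z n γ).1) + 1

/-- The limit of the second coordinates of the spinors. -/
noncomputable def scatterB (γ : ℕ → ℂ) (z : ℂ) : ℂ :=
  ∑' n, ((spinor z (n + 1) γ).2 - (spinor z n γ).2)

/-- At `z = 0` every step annihilates the second coordinate. This value fixes the constant in the
energy identity. -/
theorem scatterA_zero (γ : ℕ → ℂ) : scatterA γ 0 = 1 := by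
  simp [scatterA, spinor_zero_right]

theorem isDiskAlgebra_scatterA {γ : ℕ → ℂ} (hγ : Summable fun n => ‖γ n‖) :
    IsDiskAlgebra (scatterA γ) := by
  have hs := hγ.mul_left (Real.exp (∑' n, ‖γ n‖))
  have hb : ∀ (n : ℕ) (z : ℂ), z ∈ Metric.closedBall (0 : ℂ) 1 →
      ‖(spinor z (n + 1) γ).1 - (spinor z n γ).1‖ ≤ Real.exp (∑' n, ‖γ n‖) * ‖γ n‖ :=
    fun n z hz => (norm_spinor_sub_le_exp hγ (by simpa using hz) n).1
  have hd : ∀ n, Differentiable ℂ fun z => (spinor z (n + 1) γ).1 - (spinor z n γ).1 := fun n =>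
    (differentiable_spinor (n + 1) γ).1.sub (differentiable_spinor n γ).1
  refine DiffContOnCl.add_const ⟨?_, ?_⟩ 1
  · exact Complex.differentiableOn_tsum_of_summable_norm hs (fun n => (hd n).differentiableOn)
      Metric.isOpen_ball fun n z hz => hb n z (Metric.ball_subset_closedBall hz)
  · rw [closure_ball (0 : ℂ) one_ne_zero]
    exact continuousOn_tsum (fun n => (hd n).continuous.continuousOn) hs hb

theorem isDiskAlgebra_scatterB {γ : ℕ → ℂ} (hγ : Summable fun n => ‖γ n‖) :
    IsDiskAlgebra (scatterB γ) := by
  have hs := hγ.mul_left (Real.exp (∑' n, ‖γ n‖))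
  have hb : ∀ (n : ℕ) (z : ℂ), z ∈ Metric.closedBall (0 : ℂ) 1 →
      ‖(spinor z (n + 1) γ).2 - (spinor z n γ).2‖ ≤ Real.exp (∑' n, ‖γ n‖) * ‖γ n‖ :=
    fun n z hz => (norm_spinor_sub_le_exp hγ (by simpa using hz) n).2
  have hd : ∀ n, Differentiable ℂ fun z => (spinor z (n + 1) γ).2 - (spinor z n γ).2 := fun n =>
    (differentiable_spinor (n + 1) γ).2.sub (differentiable_spinor n γ).2
  refine ⟨?_, ?_⟩
  · exact Complex.differentiableOn_tsum_of_summable_norm hs (fun n => (hd n).differentiableOn)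
      Metric.isOpen_ball fun n z hz => hb n z (Metric.ball_subset_closedBall hz)
  · rw [closure_ball (0 : ℂ) one_ne_zero]
    exact continuousOn_tsum (fun n => (hd n).continuous.continuousOn) hs hb

theorem tendsto_spinor_fst {γ : ℕ → ℂ} (hγ : Summable fun n => ‖γ n‖) {z : ℂ}
    (hz : ‖z‖ ≤ 1) :
    Tendsto (fun n => (spinor z n γ).1) atTop (𝓝 (scatterA γ z)) := by
  have hs : Summable fun n => (spinor z (n + 1) γ).1 - (spinor z n γ).1 :=
    .of_norm_bounded (hγ.mul_left (Real.exp (∑' n, ‖γ n‖)))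
      fun n => (norm_spinor_sub_le_exp hγ hz n).1
  have h := (hs.hasSum.tendsto_sum_nat).add_const 1
  simp only [Finset.sum_range_sub fun n => (spinor z n γ).1] at h
  exact h.congr fun n => sub_add_cancel _ _

theorem tendsto_spinor_snd {γ : ℕ → ℂ} (hγ : Summable fun n => ‖γ n‖) {z : ℂ}
    (hz : ‖z‖ ≤ 1) :
    Tendsto (fun n => (spinor z n γ).2) atTop (𝓝 (scatterB γ z)) := by
  have hs : Summable fun n => (spinor z (n + 1) γ).2 - (spinor z n γ).2 :=
    .of_norm_bounded (hγ.mul_left (Real.exp (∑' n, ‖γ n‖)))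
      fun n => (norm_spinor_sub_le_exp hγ hz n).2
  have h := hs.hasSum.tendsto_sum_nat
  simp only [Finset.sum_range_sub fun n => (spinor z n γ).2] at h
  exact h.congr fun n => sub_zero _

theorem norm_scatterA_sub_one_le {γ : ℕ → ℂ} (hγ : Summable fun n => ‖γ n‖) {z : ℂ}
    (hz : ‖z‖ ≤ 1) :
    ‖scatterA γ z - 1‖ ≤ Real.exp (∑' n, ‖γ n‖) * ∑' n, ‖γ n‖ := by
  rw [scatterA, add_sub_cancel_right, ← tsum_mul_left]
  exact tsum_of_norm_bounded (hγ.mul_left _).hasSum fun n => (norm_spinor_sub_le_exp hγ hz n).1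

theorem scatter_step {γ : ℕ → ℂ} (hγ : Summable fun n => ‖γ n‖) {z : ℂ}
    (hz : ‖z‖ ≤ 1) :
    scatterA γ z = scatterA (fun k => γ (k + 1)) z
        - conj (γ 0) * scatterB (fun k => γ (k + 1)) z ∧
      scatterB γ z = z * (scatterB (fun k => γ (k + 1)) z
        + γ 0 * scatterA (fun k => γ (k + 1)) z) := by
  have hγ' : Summable fun k => ‖γ (k + 1)‖ := (summable_nat_add_iff 1).2 hγ
  have hA := tendsto_spinor_fst hγ' hz
  have hB := tendsto_spinor_snd hγ' hz
  constructor
  · refine tendsto_nhds_unique ((tendsto_add_atTop_iff_nat 1).2 (tendsto_spinor_fst hγ hz)) ?_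
    exact hA.sub (hB.const_mul _)
  · refine tendsto_nhds_unique ((tendsto_add_atTop_iff_nat 1).2 (tendsto_spinor_snd hγ hz)) ?_
    exact (hB.add (hA.const_mul _)).const_mul _

theorem tendsto_prod_one_add_norm_sq {γ : ℕ → ℂ} (hγ : Summable fun n => ‖γ n‖) {z : ℂ}
    (hz : ‖z‖ = 1) :
    Tendsto (fun n => ∏ i ∈ Finset.range n, (1 + ‖γ i‖ ^ 2)) atTop
      (𝓝 (‖scatterA γ z‖ ^ 2 + ‖scatterB γ z‖ ^ 2)) := by
  have h := ((Complex.continuous_normSq.tendsto _).comp (tendsto_spinor_fst hγ hz.le)).add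
    ((Complex.continuous_normSq.tendsto _).comp (tendsto_spinor_snd hγ hz.le))
  simp only [Function.comp_def, normSq_spinor hz] at h
  simpa only [Complex.normSq_eq_norm_sq] using h

theorem one_le_norm_sq_scatter {γ : ℕ → ℂ} (hγ : Summable fun n => ‖γ n‖) {z : ℂ}
    (hz : ‖z‖ = 1) :
    1 ≤ ‖scatterA γ z‖ ^ 2 + ‖scatterB γ z‖ ^ 2 := by
  refine ge_of_tendsto' (tendsto_prod_one_add_norm_sq hγ hz) fun n => ?_
  exact Finset.one_le_prod fun i _ => by nlinarith [sq_nonneg ‖γ i‖]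

theorem hasSum_log_one_add_norm_sq {γ : ℕ → ℂ} (hγ : Summable fun n => ‖γ n‖) {z : ℂ}
    (hz : ‖z‖ = 1) :
    HasSum (fun n => Real.log (1 + ‖γ n‖ ^ 2))
      (Real.log (‖scatterA γ z‖ ^ 2 + ‖scatterB γ z‖ ^ 2)) := by
  have h1 := one_le_norm_sq_scatter hγ hz
  rw [hasSum_iff_tendsto_nat_of_nonneg fun n => Real.log_nonneg (by nlinarith [sq_nonneg ‖γ n‖])]
  refine ((tendsto_prod_one_add_norm_sq hγ hz).log (by linarith)).congr fun n => ?_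
  exact Real.log_prod fun i _ => by positivity

/-- The two scattering functions have no common zero in the punctured closed disk. -/
theorem scatter_ne_zero {γ : ℕ → ℂ} (hγ : Summable fun n => ‖γ n‖) {z : ℂ} (hz : ‖z‖ ≤ 1)
    (hA : scatterA γ z = 0) : scatterB γ z ≠ 0 := by
  intro hB
  rcases eq_or_ne z 0 with rfl | hz0
  · rw [scatterA_zero] at hA
    exact one_ne_zero hA
  have hγk : ∀ k, Summable fun n => ‖γ (n + k)‖ := fun k => (summable_nat_add_iff k).2 hγ
  -- For `z ≠ 0` each step is invertible, so a common zero passes to every tail of the sequence,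
  -- while `scatterA` of the tails tends to one.
  have key : ∀ k, scatterA (fun n => γ (n + k)) z = 0 ∧ scatterB (fun n => γ (n + k)) z = 0 := by
    intro k
    induction k with
    | zero => exact ⟨hA, hB⟩
    | succ k ih =>
      obtain ⟨h1, h2⟩ := scatter_step (hγk k) hz
      have e : (fun n => γ (n + 1 + k)) = fun n => γ (n + (k + 1)) := by
        funext n; congr 1; ring
      rw [ih.1, e] at h1
      rw [ih.2, e] at h2
      generalize scatterA (fun n => γ (n + (k + 1))) z = X at *
      generalize scatterB (fun n => γ (n + (k + 1))) z = Y at *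
      generalize γ (0 + k) = c at *
      have h3 : Y + c * X = 0 := (mul_eq_zero.1 h2.symm).resolve_left hz0
      have h4 : (1 + (‖c‖ : ℂ) ^ 2) * X = 0 := by
        rw [← Complex.conj_mul']
        linear_combination -h1 + conj c * h3
      have hX : X = 0 :=
        (mul_eq_zero.1 h4).resolve_left (IsMarchenkoSolution.one_add_norm_sq_ne_zero c)
      exact ⟨hX, by rw [hX] at h3; simpa using h3⟩
  have ht := tendsto_tsum_norm_tail (lam := γ)
  have hlim : Tendsto (fun k => Real.exp (∑' n, ‖γ (n + k)‖) * ∑' n, ‖γ (n + k)‖) atTop (𝓝 0) := by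
    simpa using (ht.rexp).mul ht
  obtain ⟨k, hk⟩ := (hlim.eventually_lt_const (zero_lt_one (α := ℝ))).exists
  have h1 := norm_scatterA_sub_one_le (hγk k) hz
  rw [(key k).1] at h1
  simp only [zero_sub, norm_neg, norm_one] at h1
  linarith

/-! ### The energy identity -/

/-- Uniqueness of the normalization: a pair with the same boundary ratio and constant norm. -/
theorem IsScatteringPair.norm_mul_eq_one {r₀ : Circle → ℂ} {Q E : Polynomial ℂ}
    {P V D A B : ℂ → ℂ} (h : IsScatteringPair r₀ Q P V D E) (hA : IsDiskAlgebra A)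
    (hB : IsDiskAlgebra B) {N : ℝ} (hN : 0 < N)
    (hr : ∀ w : Circle, B w = A w * r₀ w)
    (hn : ∀ w : Circle, ‖A w‖ ^ 2 + ‖B w‖ ^ 2 = N) (hA0 : A 0 = 1)
    (hne : ∀ z, ‖z‖ ≤ 1 → A z = 0 → B z ≠ 0) :
    N * (‖Q.eval 0‖ ^ 2 * ‖V 0‖ ^ 2) = 1 := by
  have hQ := isDiskAlgebra_polynomial Q
  have hE := isDiskAlgebra_polynomial E
  have hfr : frontier (Metric.ball (0 : ℂ) 1) = Metric.sphere 0 1 := frontier_ball _ one_ne_zero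
  have hcl : closure (Metric.ball (0 : ℂ) 1) = Metric.closedBall 0 1 := closure_ball _ one_ne_zero
  have hcirc : ∀ z ∈ Metric.sphere (0 : ℂ) 1, ∃ w : Circle, (w : ℂ) = z := fun z hz =>
    ⟨⟨z, by simpa [Submonoid.unitSphere] using hz⟩, rfl⟩
  have hunit : ∀ w : Circle, ∃ x, unitPoint x = (w : ℂ) := fun w =>
    (toCircle_surjective w).imp fun x hx => by rw [← hx]
  have hcross : ∀ z, ‖z‖ ≤ 1 → A z * P z = Q.eval z * B z := fun z hz => by
    refine Complex.eqOn_closure_of_eqOn_frontier Metric.isBounded_ball (hA.mul h.numerator)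
      (hQ.mul hB) (fun y hy => ?_) (by rw [hcl]; simpa using hz)
    rw [hfr] at hy
    obtain ⟨w, rfl⟩ := hcirc y hy
    simp only [hr, h.boundary]
    ring
  -- The common quotient of `A` by `Q` and of `B` by `P`, written through the Bézout cofactors so
  -- that no division is needed.
  set H : ℂ → ℂ := fun z => E.eval z * V z * B z + D z * A z with hHdef
  have hH : IsDiskAlgebra H := ((hE.mul h.outer).mul hB).add (h.cofactor.mul hA)
  have hAH : ∀ z, ‖z‖ ≤ 1 → A z = Q.eval z * H z := fun z hz => by
    simp only [hHdef]
    linear_combination (-A z) * h.bezout z + E.eval z * V z * hcross z hz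
  have hBH : ∀ z, ‖z‖ ≤ 1 → B z = P z * H z := fun z hz => by
    simp only [hHdef]
    linear_combination (-B z) * h.bezout z - D z * hcross z hz
  have hH0 : ∀ z, ‖z‖ ≤ 1 → H z ≠ 0 := fun z hz h0 =>
    hne z hz (by rw [hAH z hz, h0, mul_zero]) (by rw [hBH z hz, h0, mul_zero])
  have hHV : ∀ w : Circle, ‖H w‖ = √N * ‖V w‖ := fun w => by
    obtain ⟨x, hx⟩ := hunit w
    have h1 := h.normalized x
    have h2 := hn w
    rw [hAH w (Circle.norm_coe w).le, hBH w (Circle.norm_coe w).le, norm_mul, norm_mul] at h2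
    rw [hx] at h1
    have hpos : 0 < ‖V w‖ ^ 2 := pow_pos (norm_pos_iff.2 (h.outer_ne _)) 2
    have h3 : ‖H w‖ ^ 2 = (√N * ‖V w‖) ^ 2 := by
      rw [mul_pow, Real.sq_sqrt hN.le]
      linear_combination (-‖H w‖ ^ 2) * h1 + ‖V w‖ ^ 2 * h2
    exact (pow_left_inj₀ (norm_nonneg _) (by positivity) two_ne_zero).1 h3
  have h0mem : (0 : ℂ) ∈ closure (Metric.ball (0 : ℂ) 1) := by rw [hcl]; simp
  have hsN : 0 < √N := Real.sqrt_pos.2 hN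
  have hVi : IsDiskAlgebra fun z => (V z)⁻¹ := h.outer.inv fun z _ => h.outer_ne z
  have hHi : IsDiskAlgebra fun z => (H z)⁻¹ :=
    hH.inv fun z hz => hH0 z (by rw [hcl] at hz; simpa using hz)
  -- Both `H / V` and its inverse are in the disk algebra with constant modulus on the circle; the
  -- two maximum principles pin the modulus at the origin.
  have hle1 : ‖H 0 * (V 0)⁻¹‖ ≤ √N := by
    refine Complex.norm_le_of_forall_mem_frontier_norm_le Metric.isBounded_ball
      (hH.mul hVi) (fun z hz => ?_) h0mem
    rw [hfr] at hz
    obtain ⟨w, rfl⟩ := hcirc z hz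
    have := norm_ne_zero_iff.2 (h.outer_ne (w : ℂ))
    rw [norm_mul, norm_inv, hHV, mul_assoc, mul_inv_cancel₀ this, mul_one]
  have hle2 : ‖V 0 * (H 0)⁻¹‖ ≤ (√N)⁻¹ := by
    refine Complex.norm_le_of_forall_mem_frontier_norm_le Metric.isBounded_ball
      (h.outer.mul hHi) (fun z hz => ?_) h0mem
    rw [hfr] at hz
    obtain ⟨w, rfl⟩ := hcirc z hz
    have := norm_ne_zero_iff.2 (h.outer_ne (w : ℂ))
    rw [norm_mul, norm_inv, hHV, mul_inv, mul_left_comm, mul_inv_cancel₀ this, mul_one]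
  have hV0 := norm_pos_iff.2 (h.outer_ne 0)
  have hH00 := norm_pos_iff.2 (hH0 0 (by simp))
  rw [norm_mul, norm_inv, ← div_eq_mul_inv] at hle1 hle2
  rw [div_le_iff₀ hV0] at hle1
  rw [div_le_iff₀ hH00, inv_mul_eq_div, le_div_iff₀ hsN] at hle2
  have heq : ‖H 0‖ = √N * ‖V 0‖ := le_antisymm hle1 (by linarith)
  have h1 : ‖Q.eval 0‖ * ‖H 0‖ = 1 := by
    rw [← norm_mul, ← hAH 0 (by simp), hA0, norm_one]
  rw [heq] at h1
  have h2 : √N ^ 2 = N := Real.sq_sqrt hN.le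
  rw [← h2]
  linear_combination (‖Q.eval 0‖ * (√N * ‖V 0‖) + 1) * h1

theorem spinor_ne_zero {z : ℂ} (hz : ‖z‖ = 1) (n : ℕ) (γ : ℕ → ℂ) :
    (spinor z n γ).1 ≠ 0 ∨ (spinor z n γ).2 ≠ 0 := by
  by_contra! hc
  have h := normSq_spinor hz n γ
  rw [hc.1, hc.2, map_zero, add_zero] at h
  exact (Finset.prod_pos fun i _ => by positivity : (0 : ℝ) < ∏ i ∈ Finset.range n,
    (1 + ‖γ i‖ ^ 2)).ne h

/-- The Bloch recursion preserves the distance to the spinor solution. -/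
theorem dotProduct_sub_hopf_spinor {ω : ℤ → ℂ} (hω : ∀ j, ‖ω j‖ < Real.pi) {w : Circle}
    {m : ℤ → Fin 3 → ℝ} (hm : ∀ j, m (j + 1) = precession w (pulseRotation (ω j) (m j)))
    (n : ℕ) (ρ : ℤ) :
    (m ρ - hopf (spinor w n fun k => pulseParam (ω (ρ - 1 - k))).1
        (spinor w n fun k => pulseParam (ω (ρ - 1 - k))).2) ⬝ᵥ
      (m ρ - hopf (spinor w n fun k => pulseParam (ω (ρ - 1 - k))).1
        (spinor w n fun k => pulseParam (ω (ρ - 1 - k))).2)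
      = (m (ρ - n) - ![0, 0, 1]) ⬝ᵥ (m (ρ - n) - ![0, 0, 1]) := by
  induction n generalizing ρ with
  | zero => simp only [spinor, hopf_one_zero, Nat.cast_zero, sub_zero]
  | succ n ih =>
    have e : (fun k : ℕ => pulseParam (ω (ρ - 1 - ((k + 1 : ℕ) : ℤ))))
        = fun k : ℕ => pulseParam (ω (ρ - 1 - 1 - k)) := by
      funext k
      congr 2
      push_cast
      ring
    have hmρ : m ρ = precession w (pulseRotation (ω (ρ - 1)) (m (ρ - 1))) := by
      rw [← hm, sub_add_cancel]
    have hne := spinor_ne_zero (Circle.norm_coe w) n fun k => pulseParam (ω (ρ - 1 - 1 - k))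
    have ih' := ih (ρ - 1)
    rw [spinor_succ, e, Nat.cast_zero, sub_zero]
    dsimp only
    rw [← precession_hopf, ← pulseRotation_hopf (hω _) hne, hmρ, precession_sub,
      precession_dotProduct_self, pulseRotation_sub, pulseRotation_dotProduct_self, ih']
    have e' : ρ - 1 - (n : ℤ) = ρ - ((n + 1 : ℕ) : ℤ) := by push_cast; ring
    rw [e']

/-- The distance from `m ρ` to the state produced by the last `n` pulses equals that from `m (ρ -
n)` to equilibrium, which tends to zero. -/
theorem eq_hopf_scatter {ω : ℤ → ℂ} (hω : ∀ j, ‖ω j‖ < Real.pi) {w : Circle}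
    {m : ℤ → Fin 3 → ℝ} (hm : ∀ j, m (j + 1) = precession w (pulseRotation (ω j) (m j)))
    (hlim : Tendsto m atBot (𝓝 ![0, 0, 1])) {ρ : ℤ} {γ : ℕ → ℂ}
    (hγ : γ = fun k : ℕ => pulseParam (ω (ρ - 1 - k))) (hs : Summable fun n => ‖γ n‖) :
    m ρ = hopf (scatterA γ w) (scatterB γ w) := by
  have hw := Circle.norm_coe w
  have hne : scatterA γ w ≠ 0 ∨ scatterB γ w ≠ 0 := by
    by_contra! hc
    exact scatter_ne_zero hs hw.le hc.1 hc.2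
  have hdot : Continuous fun v : Fin 3 → ℝ => v ⬝ᵥ v := continuous_id.dotProduct continuous_id
  have h1 := (hdot.tendsto _).comp (tendsto_const_nhds (x := m ρ).sub
    ((tendsto_spinor_fst hs hw.le).hopf (tendsto_spinor_snd hs hw.le) hne))
  have hbot : Tendsto (fun n : ℕ => ρ - (n : ℤ)) atTop atBot :=
    tendsto_atBot_add_const_left _ _ (tendsto_neg_atTop_atBot.comp tendsto_natCast_atTop_atTop)
  have h2 := (hdot.tendsto _).comp ((hlim.comp hbot).sub_const ![0, 0, 1])
  have h3 := tendsto_nhds_unique h1 (h2.congr fun n => by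
    subst hγ
    exact (dotProduct_sub_hopf_spinor hω hm n ρ).symm)
  rw [sub_self, zero_dotProduct, dotProduct_self_eq_zero] at h3
  exact sub_eq_zero.1 h3

theorem norm_pulseParam_le {c : ℂ} (hc : ‖c‖ ≤ 2) : ‖pulseParam c‖ ≤ ‖c‖ := by
  have hπ := Real.pi_gt_three
  rw [norm_pulseParam (by linarith), Real.tan_eq_sin_div_cos]
  have h0 := norm_nonneg c
  have h1 := Real.one_sub_sq_div_two_le_cos (x := ‖c‖ / 2)
  have h2 := Real.sin_le (x := ‖c‖ / 2) (by linarith)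
  have h3 : 1 / 2 ≤ Real.cos (‖c‖ / 2) := by nlinarith
  rw [div_le_iff₀ (by linarith)]
  nlinarith

theorem IsRephasedPulse.summable_norm_pulseParam {ρ : ℤ} {M : Circle → Fin 3 → ℝ} {ω : ℤ → ℂ}
    (h : IsRephasedPulse ρ M ω) : Summable fun k : ℕ => ‖pulseParam (ω (ρ - 1 - k))‖ := by
  have hs : Summable fun k : ℕ => ‖ω (ρ - 1 - k)‖ :=
    h.summable.comp_injective (sub_one_sub_natCast_injective ρ)
  refine Summable.of_norm_bounded_eventually_nat hs ?_
  filter_upwards [hs.tendsto_atTop_zero.eventually_le_const (zero_lt_two (α := ℝ))] with k hk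
  rw [norm_norm]
  exact norm_pulseParam_le hk

/-- After the last pulse the magnetization only precesses. -/
theorem precession_zpow_eq_of_rephasing {ω : ℤ → ℂ} {ρ : ℤ} (hω : ∀ j, ρ ≤ j → ω j = 0)
    {w : Circle} {m : ℤ → Fin 3 → ℝ}
    (hm : ∀ j, m (j + 1) = precession w (pulseRotation (ω j) (m j))) {u : Fin 3 → ℝ}
    (hlim : Tendsto (fun j : ℤ => precession (w ^ (-j)) (m j)) atTop (𝓝 u)) :
    u = precession (w ^ (-ρ)) (m ρ) := by
  refine tendsto_nhds_unique hlim (tendsto_const_nhds.congr' ?_)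
  filter_upwards [eventually_ge_atTop ρ] with j hj
  induction j, hj using Int.leInduction with
  | base => rfl
  | succ j hj ih =>
    rw [hm, hω j hj, pulseRotation_zero, precession_precession, ih, ← zpow_add_one]
    congr 2
    ring

theorem IsRephasedPulse.scatter_eq {ρ : ℤ} {M : Circle → Fin 3 → ℝ} {ω : ℤ → ℂ}
    (h : IsRephasedPulse ρ M ω) {r₀ : Circle → ℂ}
    (hM : ∀ w, M w = hopf 1 ((w : ℂ) ^ (-ρ) * r₀ w)) (w : Circle) :
    scatterB (fun k : ℕ => pulseParam (ω (ρ - 1 - k))) w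
      = scatterA (fun k : ℕ => pulseParam (ω (ρ - 1 - k))) w * r₀ w := by
  obtain ⟨m, hm, hbot, htop⟩ := h.transform w
  have hs := h.summable_norm_pulseParam
  have h1 := eq_hopf_scatter h.norm_lt_pi hm hbot rfl hs
  have h2 := precession_zpow_eq_of_rephasing h.rephasing hm htop
  have h3 : m ρ = hopf 1 (r₀ w) := by
    have e := congrArg (precession (w ^ ρ)) h2
    rw [precession_precession, ← zpow_add, add_neg_cancel, zpow_zero, precession_one, hM,
      precession_hopf, Circle.coe_zpow, ← mul_assoc, ← zpow_add₀ (Circle.coe_ne_zero w),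
      add_neg_cancel, zpow_zero, one_mul] at e
    exact e.symm
  have hne : scatterA (fun k : ℕ => pulseParam (ω (ρ - 1 - k))) w ≠ 0 ∨
      scatterB (fun k : ℕ => pulseParam (ω (ρ - 1 - k))) w ≠ 0 := by
    by_contra! hc
    exact scatter_ne_zero hs (Circle.norm_coe w).le hc.1 hc.2
  obtain ⟨hA, hBA⟩ := hopf_eq_hopf_one_iff hne (h1.symm.trans h3)
  rw [← hBA, mul_div_cancel₀ _ hA]

theorem IsRephasedPulse.hasSum_log {ρ : ℤ} {M : Circle → Fin 3 → ℝ} {ω : ℤ → ℂ}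
    (h : IsRephasedPulse ρ M ω) {r₀ : Circle → ℂ}
    (hM : ∀ w, M w = hopf 1 ((w : ℂ) ^ (-ρ) * r₀ w)) {Q E : Polynomial ℂ} {P V D : ℂ → ℂ}
    (hQ : IsScatteringPair r₀ Q P V D E) :
    HasSum (fun j : ℤ => Real.log (1 + Real.tan (‖ω j‖ / 2) ^ 2))
      (-(2 * Real.log ‖Q.eval 0‖) - 2 * Real.log ‖V 0‖) := by
  have hr := h.scatter_eq hM
  have hs := h.summable_norm_pulseParam
  have hγ : ∀ k : ℕ, ‖pulseParam (ω (ρ - 1 - k))‖ = Real.tan (‖ω (ρ - 1 - k)‖ / 2) := fun k =>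
    norm_pulseParam (h.norm_lt_pi _)
  rw [hasSum_int_iff_of_eq_zero (ρ := ρ) fun j hj => by simp [h.rephasing j hj]]
  simp only [← hγ]
  -- Any point of the circle would serve, because the product does not depend on it.
  have hsum := hasSum_log_one_add_norm_sq hs (norm_one (α := ℂ))
  have hone := one_le_norm_sq_scatter hs (norm_one (α := ℂ))
  have key := hQ.norm_mul_eq_one (isDiskAlgebra_scatterA hs) (isDiskAlgebra_scatterB hs)
    (by linarith) hr (fun w => tendsto_nhds_unique
      (tendsto_prod_one_add_norm_sq hs (Circle.norm_coe w))
      (tendsto_prod_one_add_norm_sq hs (norm_one (α := ℂ)))) (scatterA_zero _)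
    fun z hz hA => scatter_ne_zero hs hz hA
  convert hsum using 1
  have hQ0 : ‖Q.eval 0‖ ≠ 0 := norm_ne_zero_iff.2 hQ.denominator_zero
  have hV0 : ‖V 0‖ ≠ 0 := norm_ne_zero_iff.2 (hQ.outer_ne 0)
  have hlog := congrArg Real.log key
  rw [Real.log_one, Real.log_mul (by linarith) (by positivity), Real.log_mul (by positivity)
    (by positivity), Real.log_pow, Real.log_pow] at hlog
  push_cast at hlog
  linarith

/-! ### Circle means of logarithms of the pole polynomial -/

theorem log_norm_eval_polePoly {F : ℂ → ℂ} (hfin : (diskPoles F).Finite) {z : ℂ}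
    (hz : z ∉ diskPoles F) : Real.log ‖(polePoly F hfin).eval z‖
      = ∑ a ∈ hfin.toFinset, (poleMultiplicity F a : ℝ) * Real.log ‖z - a‖ := by
  rw [eval_polePoly, norm_prod, Real.log_prod fun a ha => ?_]
  · simp only [norm_pow, Real.log_pow]
  · refine norm_ne_zero_iff.2 (pow_ne_zero _ (sub_ne_zero.2 ?_))
    rintro rfl
    exact hz (hfin.mem_toFinset.1 ha)

theorem unitPoint_notMem_diskPoles {F : ℂ → ℂ} (x : AngleCircle) :
    unitPoint x ∉ diskPoles F := fun h => by
  have := h.1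
  rw [mem_ball_zero_iff, norm_unitPoint] at this
  exact lt_irrefl _ this

theorem continuous_log_norm_unitPoint_sub {a : ℂ} (ha : ‖a‖ < 1) :
    Continuous fun θ : ℝ => Real.log ‖unitPoint θ - a‖ := by
  have hc : Continuous fun θ : ℝ => unitPoint (θ : AngleCircle) :=
    continuous_unitPoint.comp continuous_quotient_mk'
  refine (hc.sub continuous_const).norm.log fun θ => norm_ne_zero_iff.2 (sub_ne_zero.2 ?_)
  rintro rfl
  exact ha.ne (norm_unitPoint _)

/-- Jensen's formula: a zero inside the disk contributes nothing to the mean of a monic linear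
factor. -/
theorem integral_log_norm_unitPoint_sub {a : ℂ} (ha : ‖a‖ < 1) :
    ∫ θ in (0 : ℝ)..(2 * Real.pi), Real.log ‖unitPoint θ - a‖ = 0 := by
  have h := circleAverage_log_norm_sub_const₀ ha
  rw [Real.circleAverage_def, smul_eq_mul] at h
  simp only [unitPoint_coe]
  exact (mul_eq_zero.1 h).resolve_left (inv_ne_zero Real.two_pi_pos.ne')

theorem continuous_log_norm_eval_polePoly {F : ℂ → ℂ} (hfin : (diskPoles F).Finite) :
    Continuous fun θ : ℝ => Real.log ‖(polePoly F hfin).eval (unitPoint θ)‖ := by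
  simp only [log_norm_eval_polePoly hfin (unitPoint_notMem_diskPoles _)]
  exact continuous_finsetSum _ fun a ha => continuous_const.mul
    (continuous_log_norm_unitPoint_sub (mem_ball_zero_iff.1 (hfin.mem_toFinset.1 ha).1))

theorem integral_log_norm_eval_polePoly {F : ℂ → ℂ} (hfin : (diskPoles F).Finite) :
    ∫ θ in (0 : ℝ)..(2 * Real.pi), Real.log ‖(polePoly F hfin).eval (unitPoint θ)‖ = 0 := by
  have hlt : ∀ a ∈ hfin.toFinset, ‖a‖ < 1 := fun a ha =>
    mem_ball_zero_iff.1 (hfin.mem_toFinset.1 ha).1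
  simp only [log_norm_eval_polePoly hfin (unitPoint_notMem_diskPoles _)]
  have hI : ∀ a ∈ hfin.toFinset, IntervalIntegrable
      (fun θ : ℝ => (poleMultiplicity F a : ℝ) * Real.log ‖unitPoint θ - a‖) volume 0
        (2 * Real.pi) := fun a ha =>
    ((continuous_log_norm_unitPoint_sub (hlt a ha)).intervalIntegrable _ _).const_mul _
  rw [intervalIntegral.integral_finsetSum hI]
  refine Finset.sum_eq_zero fun a ha => ?_
  rw [intervalIntegral.integral_const_mul, integral_log_norm_unitPoint_sub (hlt a ha), mul_zero]

/-- On the circle `|Q|² + |P|² = |Q|² (1 + |r₀|²)`, and `log |Q|` has mean zero. -/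
theorem integral_log_add_eq {r₀ : Circle → ℂ} (hr₀ : Continuous r₀) {F P : ℂ → ℂ}
    (hfin : (diskPoles F).Finite)
    (hP : ∀ w : Circle, P w = (polePoly F hfin).eval (w : ℂ) * r₀ w) :
    ∫ θ in (0 : ℝ)..(2 * Real.pi),
        Real.log (‖(polePoly F hfin).eval (unitPoint θ)‖ ^ 2 + ‖P (unitPoint θ)‖ ^ 2)
      = ∫ θ in (0 : ℝ)..(2 * Real.pi), Real.log (1 + ‖r₀ (Circle.exp θ)‖ ^ 2) := by
  have hcirc : ∀ θ : ℝ, AddCircle.toCircle (θ : AngleCircle) = Circle.exp θ := fun θ => by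
    rw [AddCircle.toCircle_apply_mk, div_self Real.two_pi_pos.ne', one_mul]
  have hpt : ∀ θ : ℝ,
      Real.log (‖(polePoly F hfin).eval (unitPoint θ)‖ ^ 2 + ‖P (unitPoint θ)‖ ^ 2)
        = 2 * Real.log ‖(polePoly F hfin).eval (unitPoint θ)‖
          + Real.log (1 + ‖r₀ (Circle.exp θ)‖ ^ 2) := fun θ => by
    have hne := norm_ne_zero_iff.2
      (eval_polePoly_ne_zero hfin (unitPoint_notMem_diskPoles (F := F) (θ : AngleCircle)))
    have hPθ : P (unitPoint θ) = (polePoly F hfin).eval (unitPoint θ) * r₀ (Circle.exp θ) := by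
      rw [← hcirc]
      exact hP _
    rw [hPθ, norm_mul, mul_pow, ← mul_one_add, Real.log_mul (pow_ne_zero 2 hne)
      (by positivity), Real.log_pow, Nat.cast_two]
  have hc : Continuous fun θ : ℝ => Real.log (1 + ‖r₀ (Circle.exp θ)‖ ^ 2) :=
    (continuous_const.add ((hr₀.comp Circle.exp.continuous).norm.pow 2)).log fun θ =>
      (add_pos_of_pos_of_nonneg one_pos (sq_nonneg _)).ne'
  simp only [hpt]
  rw [intervalIntegral.integral_add
    (((continuous_log_norm_eval_polePoly hfin).intervalIntegrable _ _).const_mul 2)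
    (hc.intervalIntegrable _ _), intervalIntegral.integral_const_mul,
    integral_log_norm_eval_polePoly, mul_zero, zero_add]

/-! ### The main theorem -/

theorem mainTheorem4 (M : Circle → Fin 3 → ℝ) (hM : ∀ w, M w ⬝ᵥ M w = 1)
    (hMz : ∀ w, M w 2 ≠ -1) (hr : MemSobolevH1 (reflectionCoeff M))
    (ρ : ℤ) (r₀ : Circle → ℂ)
    (hr₀ : ∀ w : Circle, reflectionCoeff M w = (w : ℂ) ^ (-ρ) * r₀ w)
    (F : ℂ → ℂ) (hF : IsMeromorphicExtension r₀ F) (hF₀ : Tendsto F (𝓝[≠] 0) (𝓝 0)) :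
    (diskPoles F).Finite ∧
    (∃ ω : ℤ → ℂ, IsRephasedPulse ρ M ω) ∧
    ∀ ω : ℤ → ℂ, IsRephasedPulse ρ M ω →
      HasSum (fun j : ℤ => Real.log (1 + Real.tan (‖ω j‖ / 2) ^ 2))
        (1 / (2 * Real.pi) *
            (∫ θ in (0 : ℝ)..(2 * Real.pi),
              Real.log (1 + ‖reflectionCoeff M (Circle.exp θ)‖ ^ 2))
          - 2 * ∑ᶠ z ∈ diskPoles F, (poleMultiplicity F z : ℝ) * Real.log ‖z‖) := by
  have hfin := hF.finite_diskPoles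
  have hcont : Continuous r₀ := hF.continuous
  have hzpow : ∀ n : ℤ, Continuous fun w : Circle => (w : ℂ) ^ n := fun n =>
    continuous_induced_dom.zpow₀ n fun w => Or.inl (Circle.coe_ne_zero w)
  have hrc : Continuous (reflectionCoeff M) := by
    rw [funext hr₀]
    exact (hzpow _).mul hcont
  have hsob : IsSobolevCircle fun x => r₀ (AddCircle.toCircle x) := by
    convert (isSobolevCircle_fourier ρ).mul (isSobolevCircle_of_memSobolevH1 hrc hr) using 2 with x
    rw [hr₀, ← mul_assoc, ← zpow_add₀ (Circle.coe_ne_zero _), add_neg_cancel, zpow_zero, one_mul]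
  have hMh : ∀ w, M w = hopf 1 ((w : ℂ) ^ (-ρ) * r₀ w) := fun w => by
    rw [← hr₀]
    exact eq_hopf_one_reflectionCoeff M w (hM w) (hMz w)
  obtain ⟨P, V, D, E, hpair, hV⟩ := hF.exists_isScatteringPair hF₀ hfin hsob
  refine ⟨hfin, ?_, fun ω hω => ?_⟩
  · obtain ⟨lam, a, b, hsol, hcube, hab⟩ := hpair.exists_isMarchenkoSolution
    exact hsol.exists_isRephasedPulse hcube hab hMh
  · have hnorm : ∀ w, ‖reflectionCoeff M w‖ = ‖r₀ w‖ := fun w => by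
      rw [hr₀, norm_mul, norm_zpow, Circle.norm_coe, one_zpow, one_mul]
    convert hω.hasSum_log hMh hpair using 1
    rw [hV, integral_log_add_eq hcont hfin hpair.boundary,
      log_norm_eval_polePoly hfin (zero_notMem_diskPoles hF.meromorphic hF₀),
      finsum_mem_eq_finite_toFinset_sum _ hfin]
    simp only [zero_sub, norm_neg, hnorm]
    ring
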